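/- Let $p$ be a prime, $q=p^r$, $\mathbb{F}_q$ the field with $q$ elements, $l$ a prime with $l\neq 2$ and $l\neq p$, and $k$ a field with $\operatorname{char} k\neq l$. Let $d$ be the smallest positive integer such that $l\mid q^d-1$; for $n\ge 0$ put $n_0=\lfloor n/d\rfloor$. *Essential dimension.* For a finite group $G$ and a field $F\supseteq k$, a $G$-torsor over $F$ is a nonzero commutative $F$-algebra $A$ with an action of $G$ by $F$-algebra automorphisms such that $A\otimes_F A\to\prod_{g\in G}A$, $a\otimes b\mapsto (a\,g(b))_g$, is bijective (a Galois $G$-algebra). Its essential $l$-dimension $\operatorname{ed}_k(A,l)$ is the minimum of $\operatorname{trdeg}_k K$ over all finite extensions $E/F$ with $l\nmid [E:F]$ and all intermediate fields $k\subseteq K\subseteq E$ for which there is a $G$-torsor $B$ over $K$ with $E\otimes_K B\cong E\otimes_F A$ as $G$-torsors over $E$. The essential $l$-dimension $\operatorname{ed}_k(G,l)$ is the supremum of $\operatorname{ed}_k(A,l)$ over all $F\supseteq k$ and all $G$-torsors $A$ over $F$. *Groups.* Consider the quadratic forms * $n=2m+1$, $m\ge 0$: $Q(z,x,y)=cz^2+\sum_{i=1}^m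 x_iy_i$ with any $c\in\mathbb{F}_q^\times$; * $n=2m$, $m\ge 0$, $\epsilon=+$: $Q(x,y)=\sum_{i=1}^m x_iy_i$; * $n=2m$, $m\ge 1$, $\epsilon=-$: $Q(w,x,y)=N(w)+\sum_{i=1}^{m-1}x_iy_i$ with any anisotropic quadratic form $N$ on $\mathbb{F}_q^2$. Let $O^\epsilon(n,q)=\{M\in GL_n(\mathbb{F}_q): Q(Mv)=Q(v)\text{ for all } v\}$ (no sign $\epsilon$ when $n$ is odd), let $SO^\epsilon(n,q)$ be its subgroup of elements of determinant $1$, let $\Omega^\epsilon(n,q)$ be the commutator subgroup of $SO^\epsilon(n,q)$, and $P\Omega^\epsilon(n,q)=\Omega^\epsilon(n,q)/(\Omega^\epsilon(n,q)\cap\{\pm \mathrm{Id}\})$. Then $$\operatorname{ed}_k(O^\epsilon(n,q),l)=\begin{cases} \operatorname{ed}_k(GL_m(\mathbb{F}_q),l), & n=2m+1,\ d \text{ odd},\\ & \text{or } n=2m,\ d\text{ odd},\ \epsilon=+,\\ \operatorname{ed}_k(GL_{m-1}(\mathbb{F}_q),l), & n=2m,\ d\text{ odd},\ \epsilon=-,\\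 \operatorname{ed}_k(GL_{2m}(\mathbb{F}_q),l), & n=2m+1,\ d\text{ even},\\ & \text{or } n=2m,\ d\text{ even},\ n_0\text{ even},\ \epsilon=+,\\ & \text{or } n=2m,\ d\text{ even},\ n_0\text{ odd},\ \epsilon=-,\\ \operatorname{ed}_k(GL_{2m-2}(\mathbb{F}_q),l), & n=2m,\ d\text{ even},\ n_0\text{ odd},\ \epsilon=+,\\ & \text{or } n=2m,\ d\text{ even},\ n_0\text{ even},\ \epsilon=-, \end{cases}$$ and, unless $n=2$ and $p\neq 2$, $$\operatorname{ed}_k(P\Omega^\epsilon(n,q),l)=\operatorname{ed}_k(O^\epsilon(n,q),l).$$ -/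

import Mathlib

open scoped TensorProduct MatrixGroups

universe u v

noncomputable section

namespace EssDim

/-- For a `G`-action on a commutative `F`-algebra `A`, the map `A ⊗ A → ∏_{g ∈ G} A`,
`a ⊗ b ↦ (a * g(b))_g`. It is the comorphism of `X × G → X × X`, `(x, g) ↦ (x, xg)`,
where `X = Spec A`. -/
def torsorMap (G : Type v) [Group G] (F : Type u) [Field F] (A : Type u) [CommRing A]
    [Algebra F A] [MulSemiringAction G A] [SMulCommClass G F A] :
    A ⊗[F] A →ₐ[F] (G → A) :=
  Algebra.TensorProduct.lift (Pi.constAlgHom F G A)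
    (AlgHom.pi fun g : G => MulSemiringAction.toAlgHom F A g) (fun _ _ => Commute.all _ _)

/-- A Galois `G`-algebra over a field `F`, i.e. (the coordinate ring of) a `G`-torsor over `Spec F`
for the finite constant group `G`. -/
structure GaloisAlgebra (G : Type v) [Group G] (F : Type u) [Field F] where
  carrier : Type u
  [commRing : CommRing carrier]
  [algebra : Algebra F carrier]
  [action : MulSemiringAction G carrier]
  [smulComm : SMulCommClass G F carrier]
  nontrivial : Nontrivial carrier
  bijective : Function.Bijective (torsorMap G F carrier)

attribute [instance] GaloisAlgebra.commRing GaloisAlgebra.algebra GaloisAlgebra.action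
  GaloisAlgebra.smulComm

/-- The action of `g ∈ G` on the base change `E ⊗[F] A`. -/
def baseChangeAct {G : Type v} [Group G] {F : Type u} [Field F] (A : GaloisAlgebra G F)
    (E : Type u) [Field E] [Algebra F E] (g : G) :
    E ⊗[F] A.carrier →ₐ[E] E ⊗[F] A.carrier :=
  Algebra.TensorProduct.map (AlgHom.id E E) (MulSemiringAction.toAlgHom F A.carrier g)

/-- For two subfields `K`, `F` of `E`: the torsors `B` over `K` and `A` over `F` become isomorphic
(as `G`-torsors) over `E`. -/
def BaseChangeIso {G : Type v} [Group G] {K F : Type u} [Field K] [Field F]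
    (B : GaloisAlgebra G K) (A : GaloisAlgebra G F)
    (E : Type u) [Field E] [Algebra K E] [Algebra F E] : Prop :=
  ∃ e : (E ⊗[K] B.carrier) ≃ₐ[E] (E ⊗[F] A.carrier),
    ∀ (g : G) (x : E ⊗[K] B.carrier), e (baseChangeAct B E g x) = baseChangeAct A E g (e x)

/-- The essential `l`-dimension of a `G`-torsor `A` over a field extension `F` of `k`: the minimal
transcendence degree over `k` of a field `K`, `k ⊆ K ⊆ E`, where `E / F` is finite of degree prime
to `l` and the class of `A` in `H¹(E; G)` lies in the image of `H¹(K; G)`. -/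
def essDimAtTorsor (k : Type u) [Field k] {G : Type v} [Group G] (l : ℕ)
    {F : Type u} [Field F] [Algebra k F] (A : GaloisAlgebra G F) : ℕ∞ :=
  sInf {c : ℕ∞ | ∃ (E : Type u) (_ : Field E) (_ : Algebra k E) (_ : Algebra F E)
    (_ : IsScalarTower k F E) (_ : FiniteDimensional F E) (_ : ¬ l ∣ Module.finrank F E)
    (K : IntermediateField k E) (B : GaloisAlgebra G K),
      BaseChangeIso B A E ∧ c = Cardinal.toENat (Algebra.trdeg k K)}

/-- The essential `l`-dimension `ed_k(G, l)`: the supremum over all field extensions `F / k` and all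
`G`-torsors over `F`. -/
def essDimAt (k : Type u) [Field k] (G : Type v) [Group G] (l : ℕ) : ℕ∞ :=
  sSup {c : ℕ∞ | ∃ (F : Type u) (_ : Field F) (_ : Algebra k F) (A : GaloisAlgebra G F),
    c = essDimAtTorsor k l A}

end EssDim

namespace FiniteOrthogonal

variable {F : Type v} [Field F]

/-- The split form `∑ i, x_i * y_i` on `F ^ (2m)`. -/
def plusForm (F : Type v) [Field F] (m : ℕ) : QuadraticForm F (Fin m ⊕ Fin m → F) :=
  ∑ i : Fin m, QuadraticMap.linMulLin (LinearMap.proj (Sum.inl i)) (LinearMap.proj (Sum.inr i))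

/-- The orthogonal sum on `F ^ (a + 2m)` of a form `N` on `F ^ a` and the split form on
`F ^ (2m)`. -/
def addPlusForm {a : ℕ} (N : QuadraticForm F (Fin a → F)) (m : ℕ) :
    QuadraticForm F (Fin a ⊕ (Fin m ⊕ Fin m) → F) :=
  N.comp (LinearMap.funLeft F F Sum.inl) + (plusForm F m).comp (LinearMap.funLeft F F Sum.inr)

/-- The form `c * z ^ 2 + ∑ i, x_i * y_i` on `F ^ (2m + 1)`. -/
def oddForm (c : F) (m : ℕ) : QuadraticForm F (Fin 1 ⊕ (Fin m ⊕ Fin m) → F) :=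
  addPlusForm (c • QuadraticMap.proj 0 0) m

/-- The form of minus type on `F ^ (2m)`, `1 ≤ m`: the orthogonal sum of `N`, to be taken
anisotropic, on `F ^ 2` and the split form on `F ^ (2m - 2)`. -/
def minusForm (N : QuadraticForm F (Fin 2 → F)) (m : ℕ) :
    QuadraticForm F (Fin 2 ⊕ (Fin (m - 1) ⊕ Fin (m - 1)) → F) :=
  addPlusForm N (m - 1)

variable {ι : Type} [Fintype ι] [DecidableEq ι]

/-- The orthogonal group of a quadratic form on `F ^ ι`, as a group of matrices. -/
def O (Q : QuadraticForm F (ι → F)) : Subgroup (GL ι F) where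
  carrier := {M | ∀ x : ι → F, Q ((M : Matrix ι ι F).mulVec x) = Q x}
  one_mem' := fun x => by simp
  mul_mem' := fun {M N} hM hN x => by
    rw [Units.val_mul, ← Matrix.mulVec_mulVec, hM, hN]
  inv_mem' := fun {M} hM x => by
    rw [← hM, Matrix.mulVec_mulVec, ← Units.val_mul, mul_inv_cancel, Units.val_one,
      Matrix.one_mulVec]

/-- The special orthogonal group: determinant one. -/
def SO (Q : QuadraticForm F (ι → F)) : Subgroup (GL ι F) :=
  O Q ⊓ (Matrix.GeneralLinearGroup.det (n := ι) (R := F)).ker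

/-- The commutator subgroup of the special orthogonal group. -/
def Omega (Q : QuadraticForm F (ι → F)) : Subgroup (GL ι F) := ⁅SO Q, SO Q⁆

/-- The subgroup `{1, -1}` of the general linear group. -/
def signs (F : Type v) [Field F] (ι : Type) [Fintype ι] [DecidableEq ι] : Subgroup (GL ι F) where
  carrier := {M | M = 1 ∨ M = -1}
  one_mem' := Or.inl rfl
  mul_mem' := by rintro _ _ (rfl | rfl) (rfl | rfl) <;> simp
  inv_mem' := by rintro _ (rfl | rfl) <;> simp

instance signs_normal : (signs F ι).Normal where
  conj_mem := by rintro _ (rfl | rfl) g <;> simp [signs]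

/-- `PΩ = Ω / (Ω ∩ {1, -1})`. -/
abbrev POmega (Q : QuadraticForm F (ι → F)) : Type v :=
  Omega Q ⧸ (signs F ι).subgroupOf (Omega Q)

end FiniteOrthogonal

end

/-! Essential `l`-dimension only sees a Sylow `l`-subgroup. A subgroup never has a larger one:
induce an `H`-torsor to `G`, descend the induced torsor, and recover an `H`-torsor over a finite
extension of the field of definition, which has the same transcendence degree
(`essDimAt_le_of_injective`). If `l` does not divide the index, it does not have a smaller one
either: every `G`-torsor has a reduction to `H` over an extension of degree prime to `l`
(`essDimAt_le_of_index`). Hence two finite groups agree as soon as their orders have the same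
`l`-part and some homomorphism between them has kernel of order prime to `l` (`essDimAt_eq_of_hom`).

What remains is to compare `l`-parts of orders. Reflections act transitively on nonzero singular
vectors, and the stabilizer of such a vector splits into Eichler transformations and isometries of a
space with one hyperbolic plane less. This gives the orders recursively, with `l`-adic valuations
that are sums of those of `q ^ j - 1` and `q ^ j + 1`.

For `d` odd, `l` divides no `q ^ j + 1`, and `GL_m`, embedded by `M ↦ diag(M, M⁻ᵀ)`, carries the
full `l`-part of the orthogonal groups with `m` hyperbolic planes. For `d = 2e`, the groups
`GL_{2m}`, `GL_{2m+1}` and `O(2m+1)` have the same `l`-part; those of `O⁺(2m)` and `O⁻(2m)` fall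
short of it by the `l`-parts of `q ^ m + 1` and `q ^ m - 1`. The parity of `m / e` decides which
defect vanishes. If there is a defect, the space with one hyperbolic plane less already carries the
whole `l`-part, and its group is compared with `GL_{2m-2}`.

For `PΩ`, the orthogonal group is generated by reflections and elements of order `p`. This forces
the index of `Ω` to be prime to `l`, except in dimension 2 with `p` odd; the passage to `PΩ` divides
out a 2-group. -/

noncomputable section

/-! ### Galois algebras through dual families. -/

namespace EssDim

/-- The Chase–Harrison–Rosenberg description of a Galois algebra: the invariants are the base, and
there are dual families `a`, `b` with `∑ a i * g (b i) = δ_{g,1}`. -/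
structure IsGaloisAction (G : Type*) [Group G] (F : Type*) [CommRing F] (A : Type*) [CommRing A]
    [Algebra F A] [MulSemiringAction G A] : Prop where
  mem_range : ∀ a : A, (∀ g : G, g • a = a) → ∃ c : F, algebraMap F A c = a
  exists_dual : ∃ (ι : Type) (_ : Fintype ι) (a b : ι → A),
    ∑ i, a i * b i = 1 ∧ ∀ g : G, g ≠ 1 → ∑ i, a i * g • b i = 0

section Basic

variable {G : Type*} [Group G] [Fintype G] {F : Type*} [CommRing F] {A : Type*} [CommRing A]
  [Algebra F A] [MulSemiringAction G A]

lemma smul_sum_smul (h : G) (x : A) : h • ∑ g : G, g • x = ∑ g : G, g • x := by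
  rw [Finset.smul_sum]
  simp_rw [smul_smul]
  exact Fintype.sum_equiv (Equiv.mulLeft h) _ _ (fun _ => rfl)

lemma IsGaloisAction.exists_trace (hA : IsGaloisAction G F A) (x : A) :
    ∃ c : F, algebraMap F A c = ∑ g : G, g • x :=
  hA.mem_range _ fun g => smul_sum_smul g x

/-- Summing over `i` first, duality leaves only the term `g = 1`. When traces are scalars, this
reconstruction formula shows that `a` spans the algebra and controls its stable ideals. -/
lemma sum_mul_trace {ι : Type*} [Fintype ι] {a b : ι → A} (h1 : ∑ i, a i * b i = 1)
    (h0 : ∀ g : G, g ≠ 1 → ∑ i, a i * g • b i = 0) (x : A) :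
    ∑ i, a i * ∑ g : G, g • (b i * x) = x := by
  simp_rw [Finset.mul_sum]
  rw [Finset.sum_comm, Finset.sum_eq_single_of_mem (1 : G) (Finset.mem_univ _)]
  · simp_rw [one_smul, ← mul_assoc]
    rw [← Finset.sum_mul, h1, one_mul]
  · intro g _ hg
    simp_rw [smul_mul', ← mul_assoc]
    rw [← Finset.sum_mul, h0 g hg, zero_mul]

omit [Fintype G] in
lemma dual_symm {ι : Type*} [Fintype ι] {a b : ι → A}
    (h0 : ∀ g : G, g ≠ 1 → ∑ i, a i * g • b i = 0) (g : G) (hg : g ≠ 1) :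
    ∑ i, b i * g • a i = 0 := by
  have := congrArg (g • ·) (h0 g⁻¹ (inv_ne_one.mpr hg))
  simp only [Finset.smul_sum, smul_mul', smul_inv_smul, smul_zero] at this
  simpa [mul_comm] using this

/-- A `G`-stable ideal of a Galois algebra is generated by scalars. -/
lemma IsGaloisAction.mem_of_stable (hA : IsGaloisAction G F A) (I : Ideal A)
    (hI : ∀ (g : G), ∀ x ∈ I, g • x ∈ I) {x : A} (hx : x ∈ I)
    (h : ∀ c : F, algebraMap F A c ∈ I → algebraMap F A c = 0) : x = 0 := by
  obtain ⟨ι, _, a, b, h1, h0⟩ := hA.exists_dual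
  rw [← sum_mul_trace h1 h0 x]
  refine Finset.sum_eq_zero fun i _ => ?_
  obtain ⟨c, hc⟩ := hA.exists_trace (b i * x)
  have hmem : ∑ g : G, g • (b i * x) ∈ I :=
    I.sum_mem fun g _ => hI g _ (I.mul_mem_left _ hx)
  rw [← hc] at hmem ⊢
  rw [h c hmem, mul_zero]

end Basic

section Field

variable {G : Type*} [Group G] [Fintype G] {F : Type*} [Field F] {A : Type*} [CommRing A]
  [Algebra F A] [MulSemiringAction G A]

/-- A stable ideal is generated by its scalars, and over a field a nonzero scalar is a unit. -/
lemma IsGaloisAction.eq_bot_of_stable (hA : IsGaloisAction G F A) (I : Ideal A)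
    (hI : ∀ (g : G), ∀ x ∈ I, g • x ∈ I) (hne : I ≠ ⊤) : I = ⊥ := by
  rw [eq_bot_iff]
  intro x hx
  refine hA.mem_of_stable I hI hx fun c hc => ?_
  by_contra h0
  refine hne (I.eq_top_of_isUnit_mem hc ?_)
  exact (IsUnit.mk0 c (by rintro rfl; simp at h0)).map _

lemma IsGaloisAction.finite (hA : IsGaloisAction G F A) : Module.Finite F A := by
  classical
  obtain ⟨ι, _, a, b, h1, h0⟩ := hA.exists_dual
  refine ⟨⟨Finset.univ.image a, ?_⟩⟩
  rw [eq_top_iff]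
  intro x _
  rw [← sum_mul_trace h1 h0 x]
  refine Submodule.sum_mem _ fun i _ => ?_
  obtain ⟨c, hc⟩ := hA.exists_trace (b i * x)
  rw [← hc, mul_comm, ← Algebra.smul_def]
  exact Submodule.smul_mem _ _ (Submodule.subset_span (by simp))

/-- If all traces vanished, the reconstruction formula at `1` would give `1 = 0`; a nonzero trace is
a scalar and can be normalized. -/
lemma IsGaloisAction.exists_trace_eq_one [Nontrivial A] (hA : IsGaloisAction G F A)
    [SMulCommClass G F A] : ∃ x : A, ∑ g : G, g • x = 1 := by
  obtain ⟨ι, _, a, b, h1, h0⟩ := hA.exists_dual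
  by_contra! hne
  have : (1 : A) = 0 := by
    rw [← sum_mul_trace h1 h0 1]
    refine Finset.sum_eq_zero fun i _ => ?_
    obtain ⟨c, hc⟩ := hA.exists_trace (b i * 1)
    by_cases hc0 : c = 0
    · rw [← hc, hc0, map_zero, mul_zero]
    · refine absurd ?_ (hne (c⁻¹ • (b i * 1)))
      simp_rw [smul_comm _ c⁻¹]
      rw [← Finset.smul_sum, ← hc, Algebra.smul_def, ← map_mul, inv_mul_cancel₀ hc0, map_one]
  exact one_ne_zero this

/-- An equivariant homomorphism between Galois algebras over a field is bijective. -/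
lemma IsGaloisAction.bijective_of_equivariant {B : Type*} [CommRing B] [Nontrivial B]
    [Algebra F B] [MulSemiringAction G B] (hA : IsGaloisAction G F A) (hB : IsGaloisAction G F B)
    (φ : A →ₐ[F] B) (hφ : ∀ (g : G) (x : A), φ (g • x) = g • φ x) : Function.Bijective φ := by
  constructor
  · rw [injective_iff_map_eq_zero]
    intro x hx
    have hbot := hA.eq_bot_of_stable (RingHom.ker φ)
      (fun g x hx => by rw [RingHom.mem_ker] at hx ⊢; rw [hφ, hx, smul_zero])
      (RingHom.ker_ne_top φ)
    exact hbot.le hx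
  · intro y
    obtain ⟨ι, _, a, b, h1, h0⟩ := hA.exists_dual
    -- The image of a dual family is dual in `B`, so every `y` is a combination of the `φ (a i)`
    -- with traces, that is scalars, as coefficients.
    have h1' : ∑ i, φ (a i) * φ (b i) = 1 := by simpa using congrArg φ h1
    have h0' : ∀ g : G, g ≠ 1 → ∑ i, φ (a i) * g • φ (b i) = 0 := fun g hg => by
      simpa [hφ] using congrArg φ (h0 g hg)
    rw [← sum_mul_trace h1' h0' y]
    change _ ∈ φ.range
    refine sum_mem fun i _ => mul_mem ⟨a i, rfl⟩ ?_
    obtain ⟨c, hc⟩ := hB.exists_trace (φ (b i) * y)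
    rw [← hc]
    exact φ.range.algebraMap_mem c

end Field

/-! ### Dual families versus bijectivity of the torsor map. -/

section Torsor

variable {G : Type v} [Group G] {F : Type u} [Field F] {A : Type u} [CommRing A]
  [Algebra F A] [MulSemiringAction G A] [SMulCommClass G F A]

lemma torsorMap_tmul (x y : A) (g : G) : torsorMap G F A (x ⊗ₜ y) g = x * g • y := by
  simp [torsorMap]

/-- Apply to the first tensor factor a linear functional with value `1` at `1`. -/
lemma mem_range_algebraMap_of_tmul_one_eq [Nontrivial A] {a : A}
    (h : a ⊗ₜ[F] (1 : A) = 1 ⊗ₜ a) : ∃ c : F, algebraMap F A c = a := by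
  obtain ⟨f, hf⟩ := Module.Projective.exists_dual_eq_one F (one_ne_zero (α := A))
  refine ⟨f a, ?_⟩
  have := congrArg (TensorProduct.lid F A ∘ₗ f.rTensor A : A ⊗[F] A →ₗ[F] A) h
  simpa [hf, Algebra.algebraMap_eq_smul_one] using this

/-- For invariant `a`, the tensors `a ⊗ 1` and `1 ⊗ a` have the same image. A preimage of the
indicator function of the identity, written as a sum of pure tensors, is a dual family. -/
lemma isGaloisAction_of_bijective [Fintype G] [Nontrivial A]
    (h : Function.Bijective (torsorMap G F A)) : IsGaloisAction G F A where
  mem_range a ha := by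
    refine mem_range_algebraMap_of_tmul_one_eq (h.1 ?_)
    ext g
    simp [torsorMap_tmul, ha g]
  exists_dual := by
    classical
    obtain ⟨t, ht⟩ := h.2 (Pi.single 1 1)
    obtain ⟨S, hS⟩ := TensorProduct.exists_finset t
    have key : ∀ g : G, ∑ i : Fin S.card, (S.equivFin.symm i).1.1 * g • (S.equivFin.symm i).1.2
        = (Pi.single 1 1 : G → A) g := by
      intro g
      rw [← ht, hS, map_sum, Finset.sum_apply, ← Finset.sum_coe_sort S]
      simp_rw [torsorMap_tmul]
      exact Fintype.sum_equiv S.equivFin.symm _ _ (fun _ => rfl)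
    refine ⟨Fin S.card, inferInstance, fun i => (S.equivFin.symm i).1.1,
      fun i => (S.equivFin.symm i).1.2, ?_, fun g hg => ?_⟩
    · simpa using key 1
    · simpa [hg] using key g

lemma IsGaloisAction.torsorMap_bijective [Fintype G] (hA : IsGaloisAction G F A) :
    Function.Bijective (torsorMap G F A) := by
  classical
  obtain ⟨ι, _, a, b, h1, h0⟩ := hA.exists_dual
  constructor
  -- A formula recovering a tensor from its image: the sum over `g` becomes a trace, hence a scalar
  -- that crosses the tensor sign.
  · have key : ∀ t, ∑ g : G, ∑ i, (torsorMap G F A t g * g • a i) ⊗ₜ[F] b i = t := by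
      intro t
      induction t using TensorProduct.induction_on with
      | zero => simp
      | add x y hx hy =>
        simp_rw [map_add, Pi.add_apply, add_mul, TensorProduct.add_tmul, Finset.sum_add_distrib]
        rw [hx, hy]
      | tmul x y =>
        simp_rw [torsorMap_tmul]
        rw [Finset.sum_comm]
        choose c hc using fun i => hA.exists_trace (y * a i)
        have : ∀ i, ∑ g : G, (x * g • y * g • a i) ⊗ₜ[F] b i = x ⊗ₜ (b i * ∑ g : G, g • (a i * y)) := by
          intro i
          rw [← TensorProduct.sum_tmul]
          simp_rw [mul_assoc, ← smul_mul']
          rw [← Finset.mul_sum, ← hc, mul_comm x, ← Algebra.smul_def, TensorProduct.smul_tmul,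
            Algebra.smul_def, hc, mul_comm (b i)]
          simp_rw [mul_comm y]
        simp_rw [this]
        rw [← TensorProduct.tmul_sum, sum_mul_trace (by simpa [mul_comm] using h1) (dual_symm h0)]
    exact fun s t hst => by rw [← key s, ← key t, hst]
  · intro c
    -- At `h` the inner sum pairs `a` with the translate of `b` by `h * g⁻¹`, so only `g = h`
    -- survives.
    refine ⟨∑ g : G, ∑ i, (c g * a i) ⊗ₜ (g⁻¹ • b i), ?_⟩
    ext h
    simp_rw [map_sum, Finset.sum_apply, torsorMap_tmul, smul_smul, mul_assoc, ← Finset.mul_sum]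
    rw [Finset.sum_eq_single_of_mem h (Finset.mem_univ _)]
    · simp [h1]
    · intro g _ hg
      rw [h0 _ (by rwa [ne_eq, mul_inv_eq_one, eq_comm]), mul_zero]

/-- Compare dimensions on the two sides of the torsor map. -/
lemma IsGaloisAction.finrank_eq [Fintype G] [Nontrivial A] (hA : IsGaloisAction G F A) :
    Module.finrank F A = Fintype.card G := by
  have := hA.finite
  have e := LinearEquiv.ofBijective (torsorMap G F A).toLinearMap hA.torsorMap_bijective
  have h := e.finrank_eq
  rw [Module.finrank_tensorProduct, Module.finrank_pi_fintype, Finset.sum_const,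
    Finset.card_univ, smul_eq_mul] at h
  exact Nat.eq_of_mul_eq_mul_right Module.finrank_pos h

lemma GaloisAlgebra.isGaloisAction [Fintype G] (A : GaloisAlgebra G F) :
    IsGaloisAction G F A.carrier :=
  have := A.nontrivial
  isGaloisAction_of_bijective A.bijective

/-- The Galois algebra given by a Galois action. -/
def IsGaloisAction.toGaloisAlgebra [Fintype G] [Nontrivial A] (hA : IsGaloisAction G F A) :
    GaloisAlgebra G F where
  carrier := A
  nontrivial := inferInstance
  bijective := hA.torsorMap_bijective

end Torsor

/-! ### Base change of Galois algebras. -/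

section BaseChange

variable {G : Type*} [Group G] {F : Type*} [Field F] {A : Type*} [CommRing A]
  [Algebra F A] [MulSemiringAction G A] [SMulCommClass G F A]
  {E : Type*} [Field E] [Algebra F E]

/-- The action on the second factor of `E ⊗[F] A`. -/
instance baseChangeAction : MulSemiringAction G (E ⊗[F] A) where
  smul g x := Algebra.TensorProduct.map (AlgHom.id E E) (MulSemiringAction.toAlgHom F A g) x
  one_smul x := by
    change Algebra.TensorProduct.map (AlgHom.id E E) (MulSemiringAction.toAlgHom F A 1) x = x
    have : MulSemiringAction.toAlgHom F A (1 : G) = AlgHom.id F A := by ext; simp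
    rw [this, Algebra.TensorProduct.map_id]; rfl
  mul_smul g h x := by
    change Algebra.TensorProduct.map (AlgHom.id E E) (MulSemiringAction.toAlgHom F A (g * h)) x =
      Algebra.TensorProduct.map (AlgHom.id E E) (MulSemiringAction.toAlgHom F A g)
        (Algebra.TensorProduct.map (AlgHom.id E E) (MulSemiringAction.toAlgHom F A h) x)
    induction x using TensorProduct.induction_on with
    | zero => simp
    | tmul x y => simp [mul_smul]
    | add x y hx hy => simp only [map_add, hx, hy]
  smul_zero g := map_zero _
  smul_add g := map_add _
  smul_one g := map_one _
  smul_mul g := map_mul _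

lemma smul_baseChange_tmul (g : G) (e : E) (a : A) :
    g • (e ⊗ₜ[F] a) = e ⊗ₜ[F] (g • a) := by
  change Algebra.TensorProduct.map (AlgHom.id E E) (MulSemiringAction.toAlgHom F A g) _ = _
  simp

lemma smul_baseChange_smul (g : G) (e : E) (x : E ⊗[F] A) : g • e • x = e • g • x :=
  map_smul (Algebra.TensorProduct.map (AlgHom.id E E) (MulSemiringAction.toAlgHom F A g)) e x

lemma one_tmul_algebraMap (c : F) :
    (1 : E) ⊗ₜ[F] algebraMap F A c = algebraMap E _ (algebraMap F E c) := by
  rw [Algebra.TensorProduct.algebraMap_apply, Algebra.algebraMap_eq_smul_one,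
    TensorProduct.tmul_smul, TensorProduct.smul_tmul', Algebra.smul_def, mul_one]
  rfl

lemma smul_algebraMap_baseChange (g : G) (c : E) :
    g • algebraMap E (E ⊗[F] A) c = algebraMap E _ c := by
  rw [Algebra.TensorProduct.algebraMap_apply, smul_baseChange_tmul, smul_one]

lemma IsGaloisAction.baseChange [Fintype G] [Nontrivial A] (hA : IsGaloisAction G F A) :
    IsGaloisAction G E (E ⊗[F] A) where
  mem_range x hx := by
    -- With `c` of trace one, an invariant `x` is the trace of `x * (1 ⊗ c)`, and traces are scalars
    -- by reduction to pure tensors.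
    obtain ⟨c, hc⟩ := hA.exists_trace_eq_one
    have key : ∀ y : E ⊗[F] A, ∃ e : E, algebraMap E _ e = ∑ g : G, g • y := by
      intro y
      induction y using TensorProduct.induction_on with
      | zero => exact ⟨0, by simp⟩
      | tmul e a =>
        obtain ⟨t, ht⟩ := hA.exists_trace a
        refine ⟨e * algebraMap F E t, ?_⟩
        simp_rw [smul_baseChange_tmul]
        rw [← TensorProduct.tmul_sum, ← ht, Algebra.TensorProduct.algebraMap_apply,
          Algebra.algebraMap_eq_smul_one (A := A), ← TensorProduct.smul_tmul, Algebra.smul_def,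
          mul_comm]
        rfl
      | add x y hx hy =>
        obtain ⟨s, hs⟩ := hx
        obtain ⟨t, ht⟩ := hy
        exact ⟨s + t, by simp_rw [map_add, hs, ht, smul_add, Finset.sum_add_distrib]⟩
    obtain ⟨e, he⟩ := key (x * 1 ⊗ₜ c)
    refine ⟨e, he.trans ?_⟩
    simp_rw [smul_mul', hx, smul_baseChange_tmul]
    rw [← Finset.mul_sum, ← TensorProduct.tmul_sum, hc]
    exact mul_one x
  exists_dual := by
    obtain ⟨ι, i, a, b, h1, h0⟩ := hA.exists_dual
    refine ⟨ι, i, fun i => 1 ⊗ₜ a i, fun i => 1 ⊗ₜ b i, ?_, fun g hg => ?_⟩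
    · simp_rw [Algebra.TensorProduct.tmul_mul_tmul, ← TensorProduct.tmul_sum, h1, one_mul]
      rfl
    · simp_rw [smul_baseChange_tmul, Algebra.TensorProduct.tmul_mul_tmul,
        ← TensorProduct.tmul_sum, h0 g hg, TensorProduct.tmul_zero]

end BaseChange

lemma GaloisAlgebra.baseChangeAct_apply {G : Type v} [Group G] {F : Type u} [Field F]
    (A : GaloisAlgebra G F) (E : Type u) [Field E] [Algebra F E] (g : G) (x : E ⊗[F] A.carrier) :
    baseChangeAct A E g x = g • x := rfl

/-- An equivariant map to a Galois algebra over an extension field identifies it with the base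
change. -/
lemma GaloisAlgebra.exists_baseChange_equiv {G : Type v} [Group G] [Fintype G] {K E : Type u}
    [Field K] [Field E] [Algebra K E] (B : GaloisAlgebra G K) {T : Type*} [CommRing T]
    [Nontrivial T] [Algebra E T] [MulSemiringAction G T]
    (hT : IsGaloisAction G E T) (ψ : B.carrier →+* T)
    (hψ : ∀ c : K, ψ (algebraMap K _ c) = algebraMap E T (algebraMap K E c))
    (hG : ∀ (g : G) x, ψ (g • x) = g • ψ x) (hE : ∀ (g : G) (e : E), g • algebraMap E T e = algebraMap E T e) :
    ∃ e : (E ⊗[K] B.carrier) ≃ₐ[E] T, ∀ (g : G) x, e (baseChangeAct B E g x) = g • e x := by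
  have := B.nontrivial
  let _ : Algebra K T := ((algebraMap E T).comp (algebraMap K E)).toAlgebra
  have : IsScalarTower K E T := IsScalarTower.of_algebraMap_eq fun _ => rfl
  let ψ' : B.carrier →ₐ[K] T := { ψ with commutes' := hψ }
  let Ψ : (E ⊗[K] B.carrier) →ₐ[E] T :=
    Algebra.TensorProduct.lift (Algebra.ofId E T) ψ' (fun _ _ => Commute.all _ _)
  have hΨ : ∀ (g : G) x, Ψ (g • x) = g • Ψ x := by
    intro g x
    induction x using TensorProduct.induction_on with
    | zero => simp
    | tmul e a =>
      rw [smul_baseChange_tmul]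
      simp only [Ψ, Algebra.TensorProduct.lift_tmul, smul_mul']
      congr 1
      · exact (hE g e).symm
      · exact hG g a
    | add x y hx hy => simp only [smul_add, map_add, hx, hy]
  exact ⟨AlgEquiv.ofBijective Ψ (B.isGaloisAction.baseChange.bijective_of_equivariant hT Ψ hΨ), hΨ⟩

/-! ### Induction of Galois algebras from a subgroup. -/

section Induced

variable {G H : Type*} [Group G] [Group H] (f : H →* G) (F : Type*) [Field F] (R : Type*)
  [CommRing R] [Algebra F R] [MulSemiringAction H R] [SMulCommClass H F R]

/-- The functions `G → R` with `φ (f h * g) = h • φ g`. -/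
def indSubalgebra : Subalgebra F (G → R) where
  carrier := {φ | ∀ h g, φ (f h * g) = h • φ g}
  mul_mem' := fun {x y} hx hy h g => by simp [hx h g, hy h g]
  add_mem' := fun {x y} hx hy h g => by simp [hx h g, hy h g]
  algebraMap_mem' := fun c h g => by simp

/-- The algebra induced along `f : H →* G` from an algebra with an action of `H`. -/
abbrev Ind : Type _ := indSubalgebra f F R

variable {f F R}

lemma Ind.ext {x y : Ind f F R} (h : ∀ g, x.1 g = y.1 g) : x = y := Subtype.ext (funext h)

lemma Ind.sum_apply {ι : Type*} (s : Finset ι) (x : ι → Ind f F R) (g : G) :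
    (∑ i ∈ s, x i).1 g = ∑ i ∈ s, (x i).1 g := by
  have : (∑ i ∈ s, x i).1 = ∑ i ∈ s, (x i).1 := map_sum (indSubalgebra f F R).val x s
  rw [this, Finset.sum_apply]

instance : MulSemiringAction G (Ind f F R) where
  smul g x := ⟨fun y => x.1 (y * g), fun h y => by simpa only [mul_assoc] using x.2 h (y * g)⟩
  one_smul x := Ind.ext fun y => congrArg x.1 (mul_one y)
  mul_smul g h x := Ind.ext fun y => congrArg x.1 (mul_assoc y g h).symm
  smul_zero g := rfl
  smul_add g _ _ := rfl
  smul_one g := rfl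
  smul_mul g _ _ := rfl

lemma Ind.smul_apply (g : G) (x : Ind f F R) (y : G) : (g • x).1 y = x.1 (y * g) := rfl

instance : SMulCommClass G F (Ind f F R) where
  smul_comm _ _ _ := rfl

variable (f F R) in
/-- Evaluation at `1`. -/
def Ind.eval : Ind f F R →ₐ[F] R := (Pi.evalAlgHom F (fun _ : G => R) 1).comp
  (indSubalgebra f F R).val

lemma Ind.eval_apply (x : Ind f F R) : Ind.eval f F R x = x.1 1 := rfl

lemma Ind.eval_smul (h : H) (x : Ind f F R) : Ind.eval f F R (f h • x) = h • Ind.eval f F R x := by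
  rw [eval_apply, eval_apply, smul_apply, one_mul, ← x.2 h 1, mul_one]

/-- The equivariant map to the induced algebra given by a map to the original one. -/
def Ind.lift {P : Type*} [CommRing P] [MulSemiringAction G P]
    (φ : P →+* R) (hφ : ∀ h x, φ (f h • x) = h • φ x) : P →+* Ind f F R :=
  RingHom.codRestrict (RingHom.pi fun g : G => φ.comp (MulSemiringAction.toRingHom G P g))
    (indSubalgebra f F R) (fun x h g => by
      change φ ((f h * g) • x) = h • φ (g • x)
      rw [mul_smul, hφ])

lemma Ind.lift_apply {P : Type*} [CommRing P] [MulSemiringAction G P]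
    (φ : P →+* R) (hφ : ∀ h x, φ (f h • x) = h • φ x) (x : P) (g : G) :
    (Ind.lift (F := F) φ hφ x).1 g = φ (g • x) := rfl

lemma Ind.lift_smul {P : Type*} [CommRing P] [MulSemiringAction G P]
    (φ : P →+* R) (hφ : ∀ h x, φ (f h • x) = h • φ x) (g : G) (x : P) :
    Ind.lift (F := F) φ hφ (g • x) = g • Ind.lift (F := F) φ hφ x :=
  Ind.ext fun y => congrArg φ (smul_smul y g x)

instance [Nontrivial R] : Nontrivial (Ind f F R) := (Ind.eval f F R).toRingHom.domain_nontrivial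

/-- `τ` picks representatives of the right cosets of `f.range` and `σ` is the coordinate in `H`.
This is used to extend dual families by zero from single cosets. -/
lemma exists_coset_decomposition (f : H →* G) :
    ∃ (σ : G → H) (τ : G → G), (∀ x, f (σ x) * τ x = x) ∧ ∀ h x, τ (f h * x) = τ x := by
  let τ : G → G := fun x => (Quotient.mk (QuotientGroup.rightRel f.range) x).out
  have h1 : ∀ x, ∃ h, f h * τ x = x := by
    intro x
    obtain ⟨h, hh⟩ := QuotientGroup.rightRel_apply.mp
      (Quotient.mk_out (s := QuotientGroup.rightRel f.range) x)
    exact ⟨h, by rw [hh]; simp [τ]⟩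
  choose σ hσ using h1
  refine ⟨σ, τ, hσ, fun h x => ?_⟩
  simp only [τ]
  congr 1
  exact Quotient.sound (QuotientGroup.rightRel_apply.mpr ⟨h⁻¹, by simp⟩)

lemma IsGaloisAction.ind {G : Type} [Group G] [Fintype G] {f : H →* G}
    (hf : Function.Injective f) (hR : IsGaloisAction H F R) : IsGaloisAction G F (Ind f F R) where
  mem_range x hx := by
    have hc : ∀ g, x.1 g = x.1 1 := fun g => by
      rw [← congrArg (fun y : Ind f F R => y.1 1) (hx g), Ind.smul_apply, one_mul]
    obtain ⟨c, hc'⟩ := hR.mem_range (x.1 1) fun h => by rw [← x.2 h 1, hc]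
    exact ⟨c, Ind.ext fun g => hc'.trans (hc g).symm⟩
  exists_dual := by
    classical
    obtain ⟨ι, _, a, b, h1, h0⟩ := hR.exists_dual
    obtain ⟨σ, τ, hστ, hτ⟩ := exists_coset_decomposition f
    have hσ : ∀ h x, σ (f h * x) = h * σ x := by
      intro h x
      apply hf
      have e1 := hστ (f h * x)
      have e2 : f (σ (f h * x)) * τ x = f (h * σ x) * τ x := by
        rw [hτ] at e1
        rw [e1, map_mul, mul_assoc, hστ]
      exact mul_right_cancel e2
    -- The equivariant function supported on the coset represented by `t`, with value `r` there. It
    -- vanishes if `t` is not one of the chosen representatives, so letting `t` run over all of `G`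
    -- is harmless.
    let ext (r : R) (t : G) : Ind f F R :=
      ⟨fun x => if τ x = t then σ x • r else 0, fun h x => by
        simp only [hσ, hτ, mul_smul]; split_ifs <;> simp⟩
    have hext : ∀ r t x, (ext r t).1 x = if τ x = t then σ x • r else 0 := fun _ _ _ => rfl
    have key : ∀ x y : G, ∑ i : ι × G, (ext (a i.1) i.2).1 x * (ext (b i.1) i.2).1 y =
        if x = y then 1 else 0 := by
      intro x y
      rw [Fintype.sum_prod_type_right]
      simp_rw [hext]
      rw [Finset.sum_eq_single_of_mem (τ x) (Finset.mem_univ _) (fun t _ ht => by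
        simp [ht.symm])]
      simp only [if_true]
      by_cases hxy : τ y = τ x
      · simp only [hxy, if_true]
        have : ∀ i, σ x • a i * σ y • b i = σ x • (a i * ((σ x)⁻¹ * σ y) • b i) := by
          intro i; rw [smul_mul', smul_smul, mul_inv_cancel_left]
        simp_rw [this]
        rw [← Finset.smul_sum]
        by_cases hs : (σ x)⁻¹ * σ y = 1
        · have hs' : σ x = σ y := inv_mul_eq_one.mp hs
          have : x = y := by rw [← hστ x, ← hστ y, hs', hxy]
          rw [hs]
          simp [this, h1]
        · rw [h0 _ hs, smul_zero, if_neg]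
          rintro rfl
          simp at hs
      · simp only [hxy, if_false, mul_zero, Finset.sum_const_zero]
        rw [if_neg]
        rintro rfl
        exact hxy rfl
    refine ⟨ι × G, inferInstance, fun i => ext (a i.1) i.2, fun i => ext (b i.1) i.2, ?_, ?_⟩
    · refine Ind.ext fun x => ?_
      rw [Ind.sum_apply]
      exact (key x x).trans (if_pos rfl)
    · intro g hg
      refine Ind.ext fun x => ?_
      rw [Ind.sum_apply]
      exact (key x (x * g)).trans (if_neg (by simpa using hg))

end Induced

/-! ### Galois algebras obtained as images of equivariant maps. -/

section Descent

variable {G H : Type*} [Group G] [Group H] [Fintype G] [Fintype H] {f : H →* G}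
  {k K E : Type u} [Field k] [Field K] [Field E] [Algebra k K] [Algebra k E] [Algebra K E]
  [IsScalarTower k K E]
  {T : Type u} [CommRing T] [Nontrivial T] [Algebra E T] [Algebra K T] [IsScalarTower K E T]
  [MulSemiringAction H T]

/-- The scalars of `E` in a finite-dimensional `K`-subalgebra of an `E`-algebra. -/
def scalarField (k : Type u) [Field k] [Algebra k K] [Algebra k E] [IsScalarTower k K E]
    (S : Subalgebra K T) [FiniteDimensional K S] : IntermediateField k E :=
  have hinv : ∀ x : E, algebraMap E T x ∈ S → algebraMap E T x⁻¹ ∈ S := fun x hx => by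
    -- The scalars in `S` form a subring of the field `E` of finite dimension over `K`, hence closed
    -- under inversion.
    let S' : Subalgebra K E := S.comap (IsScalarTower.toAlgHom K E T)
    let ι : S' →ₗ[K] S := LinearMap.restrict (IsScalarTower.toAlgHom K E T).toLinearMap
      (p := S'.toSubmodule) (q := S.toSubmodule) (fun _ h => h)
    have hι : Function.Injective ι := fun a b hab =>
      Subtype.ext ((algebraMap E T).injective (congrArg Subtype.val hab))
    have : FiniteDimensional K S' := FiniteDimensional.of_injective ι hι
    have hx' : x ∈ S' := hx
    exact S'.inv_mem_of_algebraic (x := ⟨x, hx'⟩)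
      (Algebra.IsAlgebraic.isAlgebraic (R := K) (⟨x, hx'⟩ : S')).algebraMap
  { carrier := {x | algebraMap E T x ∈ S}
    mul_mem' := fun {a b} ha hb => by
      simpa only [Set.mem_ofPred_eq, map_mul] using mul_mem ha hb
    add_mem' := fun {a b} ha hb => by
      simpa only [Set.mem_ofPred_eq, map_add] using add_mem ha hb
    algebraMap_mem' := fun c => by
      rw [IsScalarTower.algebraMap_apply k K E, Set.mem_ofPred_eq,
        ← IsScalarTower.algebraMap_apply K E T]
      exact S.algebraMap_mem _
    inv_mem' := fun x hx => hinv x hx }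

lemma mem_scalarField {S : Subalgebra K T} [FiniteDimensional K S] {x : E} :
    x ∈ scalarField (E := E) k S ↔ algebraMap E T x ∈ S := Iff.rfl

/-- If a Galois `G`-algebra over `K` maps `H`-equivariantly to a ring with an action of `H` whose
invariants are the field `E`, then its image is a Galois `H`-algebra over a subfield of `E`. -/
theorem GaloisAlgebra.exists_descent (k : Type u) [Field k] [Algebra k K] [Algebra k E]
    [IsScalarTower k K E] (hf : Function.Injective f) (B : GaloisAlgebra G K)
    (hT : ∀ t : T, (∀ h : H, h • t = t) → ∃ c : E, algebraMap E T c = t)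
    (hE : ∀ (h : H) (c : E), h • algebraMap E T c = algebraMap E T c)
    (φ : B.carrier →ₐ[K] T) (hφ : ∀ h x, φ (f h • x) = h • φ x) :
    ∃ (K' : IntermediateField k E) (_ : Algebra K K') (_ : IsScalarTower K K' E)
      (_ : FiniteDimensional K K') (R : GaloisAlgebra H K')
      (α : B.carrier →+* R.carrier) (β : R.carrier →+* T),
      (∀ c, α (algebraMap K _ c) = algebraMap K' _ (algebraMap K K' c)) ∧
      (∀ (h : H) x, α (f h • x) = h • α x) ∧
      (∀ c : K', β (algebraMap K' _ c) = algebraMap E T c) ∧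
      (∀ (h : H) x, β (h • x) = h • β x) ∧
      Module.finrank K φ.range = Module.finrank K K' * Fintype.card H := by
  have := B.nontrivial
  have := B.isGaloisAction.finite
  have : FiniteDimensional K φ.range :=
    inferInstanceAs (FiniteDimensional K (LinearMap.range φ.toLinearMap))
  let K' : IntermediateField k E := scalarField k φ.range
  have hK : ∀ c : K, algebraMap K E c ∈ K' := fun c => by
    rw [mem_scalarField, ← IsScalarTower.algebraMap_apply K E T]
    exact φ.range.algebraMap_mem c
  let iK : Algebra K K' := ((algebraMap K E).codRestrict K'.toSubfield hK).toAlgebra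
  have tK : IsScalarTower K K' E := IsScalarTower.of_algebraMap_eq fun _ => rfl
  let iR : Algebra K' φ.range :=
    (((algebraMap E T).comp (algebraMap K' E)).codRestrict φ.range.toSubring
      (fun c => c.2)).toAlgebra
  have tR : IsScalarTower K K' φ.range := IsScalarTower.of_algebraMap_eq fun c =>
    Subtype.ext (IsScalarTower.algebraMap_apply K E T c)
  have finK : FiniteDimensional K K' := FiniteDimensional.left K K' φ.range
  let act : MulSemiringAction H φ.range :=
    { smul := fun h x => ⟨h • x.1, by
        obtain ⟨y, hy⟩ := x.2
        exact ⟨f h • y, by rw [← hy]; exact hφ h y⟩⟩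
      one_smul := fun x => Subtype.ext (one_smul _ _)
      mul_smul := fun g h x => Subtype.ext (mul_smul _ _ _)
      smul_zero := fun g => Subtype.ext (smul_zero _)
      smul_add := fun g x y => Subtype.ext (smul_add _ _ _)
      smul_one := fun g => Subtype.ext (smul_one _)
      smul_mul := fun g x y => Subtype.ext (smul_mul' _ _ _) }
  have comm : SMulCommClass H K' φ.range := ⟨fun h c x => by
    rw [Algebra.smul_def, smul_mul', Algebra.smul_def]
    congr 1
    exact Subtype.ext (hE h c)⟩
  -- The invariants are scalars by `hT`. The dual family of `B` pushes forward to a dual family for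
  -- `H`, because `f` is injective.
  have hR : IsGaloisAction H K' φ.range :=
    { mem_range := fun a ha => by
        obtain ⟨c, hc⟩ := hT a.1 fun h => congrArg Subtype.val (ha h)
        exact ⟨⟨c, by rw [mem_scalarField, hc]; exact a.2⟩, Subtype.ext hc⟩
      exists_dual := by
        obtain ⟨ι, i, a, b, h1, h0⟩ := B.isGaloisAction.exists_dual
        have hr : ∀ h x, φ.rangeRestrict (f h • x) = h • φ.rangeRestrict x :=
          fun h x => Subtype.ext (hφ h x)
        refine ⟨ι, i, fun i => φ.rangeRestrict (a i), fun i => φ.rangeRestrict (b i), ?_, ?_⟩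
        · simpa using congrArg φ.rangeRestrict h1
        · intro h hh
          simpa only [map_sum, map_mul, hr, map_zero] using congrArg φ.rangeRestrict (h0 (f h)
            (by rwa [ne_eq, map_eq_one_iff f hf])) }
  refine ⟨K', iK, tK, finK, hR.toGaloisAlgebra, φ.rangeRestrict.toRingHom, φ.range.val.toRingHom,
    fun c => ?_, fun h x => Subtype.ext (hφ h x), fun c => rfl, fun h x => rfl, ?_⟩
  · exact (φ.rangeRestrict.commutes c).trans (IsScalarTower.algebraMap_apply K K' φ.range c)
  · have : Module.Free K' φ.range := Module.Free.of_divisionRing K' φ.range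
    rw [← Module.finrank_mul_finrank K K' φ.range, hR.finrank_eq]

end Descent

/-! ### Subgroups do not have larger essential dimension. -/

section Monotone

/-- The essential dimension of a subgroup is at most that of the group. -/
theorem essDimAt_le_of_injective {k : Type u} [Field k] {G H : Type} [Group G] [Group H]
    [Fintype G] [Fintype H] {f : H →* G} (hf : Function.Injective f) (l : ℕ) :
    essDimAt k H l ≤ essDimAt k G l := by
  refine sSup_le ?_
  rintro _ ⟨F, iF, ikF, A, rfl⟩
  have := A.nontrivial
  -- A model `B` over `K` of the induced torsor `P` maps to `E ⊗ A` by evaluation at `1`. The image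
  -- of `B` is a model of `A` over a finite extension `K'` of `K` inside `E`.
  let P : GaloisAlgebra G F := (A.isGaloisAction.ind hf).toGaloisAlgebra
  refine le_trans ?_ (le_sSup ⟨F, iF, ikF, P, rfl⟩)
  refine le_sInf ?_
  rintro c ⟨E, iE, ikE, iFE, tE, hfin, hl, K, B, ⟨e, he⟩, rfl⟩
  let ev : (E ⊗[F] P.carrier) →ₐ[E] (E ⊗[F] A.carrier) :=
    Algebra.TensorProduct.map (AlgHom.id E E) (Ind.eval f F A.carrier)
  have hev : ∀ (h : H) x, ev (f h • x) = h • ev x := by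
    intro h x
    induction x using TensorProduct.induction_on with
    | zero => simp
    | tmul y a =>
      rw [smul_baseChange_tmul]
      change y ⊗ₜ _ = h • (y ⊗ₜ _)
      rw [smul_baseChange_tmul]
      congr 1
      exact Ind.eval_smul h a
    | add x y hx hy => simp only [smul_add, map_add, hx, hy]
  have hA := A.isGaloisAction.baseChange (E := E)
  have : Nontrivial (E ⊗[F] A.carrier) := inferInstance
  let φ : B.carrier →ₐ[K] (E ⊗[F] A.carrier) :=
    { (ev.toRingHom.comp e.toRingEquiv.toRingHom).comp
        (Algebra.TensorProduct.includeRight : B.carrier →ₐ[K] E ⊗[K] B.carrier).toRingHom with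
      commutes' := fun c => by
        change ev (e (1 ⊗ₜ algebraMap K _ c)) = algebraMap E _ (algebraMap K E c)
        rw [one_tmul_algebraMap, e.commutes, ev.commutes] }
  have hφ : ∀ h x, φ (f h • x) = h • φ x := by
    intro h x
    change ev (e (1 ⊗ₜ (f h • x))) = h • ev (e (1 ⊗ₜ x))
    rw [← hev, ← smul_baseChange_tmul, ← GaloisAlgebra.baseChangeAct_apply, he]
    rfl
  obtain ⟨K', iK, tK, finK, R, α, β, hα, hα', hβ, hβ', -⟩ :=
    B.exists_descent k hf hA.mem_range smul_algebraMap_baseChange φ hφ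
  obtain ⟨e', he'⟩ := R.exists_baseChange_equiv hA β hβ hβ' smul_algebraMap_baseChange
  refine sInf_le ⟨E, iE, ikE, iFE, tE, hfin, hl, K', R, ⟨e', he'⟩, ?_⟩
  have : IsScalarTower k K K' := IsScalarTower.of_algebraMap_eq fun c => by
    apply (algebraMap K' E).injective
    rw [← IsScalarTower.algebraMap_apply K K' E, ← IsScalarTower.algebraMap_apply k K' E,
      ← IsScalarTower.algebraMap_apply k K E]
  -- `K'` is algebraic over `K`, so the transcendence degree is unchanged.
  have h := _root_.trdeg_add_eq k K (A := K')
  rw [_root_.trdeg_eq_zero (R := K) (A := K'), add_zero] at h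
  rw [h]

end Monotone

/-! ### Reduction to a subgroup of index prime to `l`. -/

section Index

lemma finrank_quotient_inf {F A : Type*} [Field F] [CommRing A] [Algebra F A] [Module.Finite F A]
    {I J : Ideal A} (h : I ⊔ J = ⊤) :
    Module.finrank F (A ⧸ (I ⊓ J)) = Module.finrank F (A ⧸ I) + Module.finrank F (A ⧸ J) := by
  let c (I : Ideal A) : Submodule F A := I.restrictScalars F
  have key : ∀ I : Ideal A, Module.finrank F (A ⧸ I) + Module.finrank F (c I) =
      Module.finrank F A := fun I => (c I).finrank_quotient_add_finrank
  have h1 : c I ⊔ c J = ⊤ := by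
    rw [eq_top_iff]
    intro x _
    obtain ⟨y, hy, z, hz, rfl⟩ := Submodule.mem_sup.mp (h.ge (Submodule.mem_top (x := x)))
    exact Submodule.add_mem_sup (T := c J) hy hz
  have h2 : c I ⊓ c J = c (I ⊓ J) := rfl
  have h3 := Submodule.finrank_sup_add_finrank_inf_eq (c I) (c J)
  rw [h1, h2, finrank_top] at h3
  have := key I
  have := key J
  have := key (I ⊓ J)
  omega

variable {G H : Type} [Group G] [Group H] {f : H →* G} {F : Type u} [Field F]

/-- The largest `H`-stable ideal contained in `I`. -/
def stableCore {A : Type*} [CommRing A] [MulSemiringAction G A] (f : H →* G) (I : Ideal A) :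
    Ideal A :=
  ⨅ h : H, I.comap (MulSemiringAction.toRingHom G A (f h))

lemma mem_stableCore {A : Type*} [CommRing A] [MulSemiringAction G A] {I : Ideal A} {x : A} :
    x ∈ stableCore f I ↔ ∀ h : H, f h • x ∈ I := by
  simp [stableCore, Ideal.mem_comap]

/-- The intersection of all maximal ideals is proper and `G`-stable, hence zero; the stable cores
are smaller still. -/
lemma GaloisAlgebra.iInf_stableCore_eq_bot [Fintype G] (A : GaloisAlgebra G F) (f : H →* G) :
    ⨅ M : MaximalSpectrum A.carrier, stableCore f M.asIdeal = ⊥ := by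
  have := A.nontrivial
  have h : ⨅ M : MaximalSpectrum A.carrier, M.asIdeal = ⊥ := by
    refine A.isGaloisAction.eq_bot_of_stable _ (fun g x hx => ?_) ?_
    · rw [Ideal.mem_iInf] at hx ⊢
      intro M
      have := M.isMaximal
      exact hx ⟨M.asIdeal.comap (MulSemiringAction.toRingEquiv G A.carrier g), inferInstance⟩
    · obtain ⟨M, hM⟩ := Ideal.exists_maximal A.carrier
      exact ne_top_of_le_ne_top hM.ne_top (iInf_le _ (⟨M, hM⟩ : MaximalSpectrum A.carrier))
  rw [eq_bot_iff, ← h]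
  refine iInf_mono fun M x hx => ?_
  simpa using mem_stableCore.mp hx 1

variable [Fintype H]

/-- Stable cores correspond to `H`-orbits of maximal ideals. A new orbit is comaximal to the
previous intersection and adds its dimension; an old one changes nothing. -/
lemma dvd_finrank_quotient_iInf_stableCore {A : Type*} [CommRing A] [Algebra F A]
    [Module.Finite F A] [MulSemiringAction G A] {n : ℕ}
    (h : ∀ M : MaximalSpectrum A, n ∣ Module.finrank F (A ⧸ stableCore f M.asIdeal))
    (s : Finset (MaximalSpectrum A)) :
    n ∣ Module.finrank F (A ⧸ ⨅ M ∈ s, stableCore f M.asIdeal) := by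
  classical
  induction s using Finset.induction_on with
  | empty =>
    have : Subsingleton (A ⧸ ⨅ M ∈ (∅ : Finset (MaximalSpectrum A)), stableCore f M.asIdeal) := by
      rw [Ideal.Quotient.subsingleton_iff]; simp
    rw [Module.finrank_zero_of_subsingleton]
    exact dvd_zero n
  | insert M s hM ih =>
    rw [Finset.iInf_insert]
    set J := ⨅ M ∈ s, stableCore f M.asIdeal with hJ
    have hstab : ∀ (h : H), ∀ x ∈ J, f h • x ∈ J := by
      intro h x hx
      simp only [hJ, Ideal.mem_iInf, mem_stableCore] at hx ⊢
      intro N hN h'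
      rw [smul_smul, ← map_mul]
      exact hx N hN (h' * h)
    by_cases htop : stableCore f M.asIdeal ⊔ J = ⊤
    · rw [finrank_quotient_inf htop]
      exact dvd_add (h M) ih
    -- A maximal ideal `N` above both is a translate of `M`; since `J` is stable and lies in `N`, it
    -- lies in every translate of `M`.
    · have hle : J ≤ stableCore f M.asIdeal := by
        obtain ⟨N, hN, hle⟩ := Ideal.exists_le_maximal _ htop
        have hNp := hN.isPrime
        have h1 : stableCore f M.asIdeal ≤ N := le_sup_left.trans hle
        obtain ⟨h0, -, hh0⟩ := (Ideal.IsPrime.inf_le' (s := Finset.univ) hNp).mp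
          (by simpa [stableCore, Finset.inf_univ_eq_iInf] using h1)
        have hMh : (M.asIdeal.comap (MulSemiringAction.toRingHom G A (f h0))).IsMaximal := by
          have := M.isMaximal
          exact Ideal.comap_isMaximal_of_equiv (MulSemiringAction.toRingEquiv G A (f h0))
        have hN' := hMh.eq_of_le hN.ne_top hh0
        intro x hx
        rw [mem_stableCore]
        intro h
        have hxN : f (h0⁻¹ * h) • x ∈ N := hle (Ideal.mem_sup_right (hstab _ _ hx))
        rw [← hN', Ideal.mem_comap] at hxN
        simpa [smul_smul] using hxN
      rw [inf_eq_right.mpr hle]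
      exact ih

variable [Fintype G]

/-- A Galois `G`-algebra admits a reduction to `H` over an extension of degree not divisible
by `l`, if `l` does not divide the index of `H`. -/
theorem GaloisAlgebra.exists_reduction (hf : Function.Injective f) {l : ℕ}
    (hl : ¬ l * Fintype.card H ∣ Fintype.card G) (A : GaloisAlgebra G F) :
    ∃ (F' : Type u) (_ : Field F') (_ : Algebra F F') (_ : FiniteDimensional F F')
      (R : GaloisAlgebra H F') (α : A.carrier →+* R.carrier),
      ¬ l ∣ Module.finrank F F' ∧
      (∀ c, α (algebraMap F _ c) = algebraMap F' _ (algebraMap F F' c)) ∧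
      (∀ (h : H) x, α (f h • x) = h • α x) := by
  have := A.nontrivial
  have hfin := A.isGaloisAction.finite
  -- `A` is the product of its quotients by the stable cores of the orbits, and has dimension `|G|`.
  -- So the divisibility must fail for some orbit.
  have key : ∃ M : MaximalSpectrum A.carrier,
      ¬ l * Fintype.card H ∣ Module.finrank F (A.carrier ⧸ stableCore f M.asIdeal) := by
    by_contra! hall
    have : IsArtinianRing A.carrier := IsArtinianRing.of_finite F A.carrier
    have := Fintype.ofFinite (MaximalSpectrum A.carrier)
    have h := dvd_finrank_quotient_iInf_stableCore hall Finset.univ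
    have hbot : ⨅ M ∈ (Finset.univ : Finset (MaximalSpectrum A.carrier)),
        stableCore f M.asIdeal = ⊥ := by
      simpa using A.iInf_stableCore_eq_bot f
    rw [hbot] at h
    refine hl ?_
    rwa [← A.isGaloisAction.finrank_eq,
      (AlgEquiv.quotientBot F A.carrier).toLinearEquiv.finrank_eq.symm]
  obtain ⟨M, hM⟩ := key
  have := M.isMaximal
  let _ : Field (A.carrier ⧸ M.asIdeal) := Ideal.Quotient.field M.asIdeal
  let act : MulSemiringAction H (H → A.carrier ⧸ M.asIdeal) :=
    { smul := fun h φ y => φ (y * h)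
      one_smul := fun φ => funext fun y => congrArg φ (mul_one y)
      mul_smul := fun g h φ => funext fun y => congrArg φ (mul_assoc y g h).symm
      smul_zero := fun _ => rfl
      smul_add := fun _ _ _ => rfl
      smul_one := fun _ => rfl
      smul_mul := fun _ _ _ => rfl }
  -- The kernel is the stable core of `M`. The image will be a Galois `H`-algebra over some `F'`, so
  -- its dimension is `[F' : F] * |H|`, and the choice of `M` gives `l ∤ [F' : F]`.
  let φ : A.carrier →ₐ[F] (H → A.carrier ⧸ M.asIdeal) :=
    AlgHom.pi fun h => (Ideal.Quotient.mkₐ F M.asIdeal).comp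
      (MulSemiringAction.toAlgHom F A.carrier (f h))
  have hφ : ∀ h x, φ (f h • x) = h • φ x := by
    intro h x
    funext y
    change Ideal.Quotient.mk M.asIdeal (f y • f h • x) = Ideal.Quotient.mk M.asIdeal (f (y * h) • x)
    rw [map_mul, mul_smul]
  have hker : RingHom.ker φ = stableCore f M.asIdeal := by
    ext x
    rw [RingHom.mem_ker, mem_stableCore, funext_iff]
    exact forall_congr' fun h => Ideal.Quotient.eq_zero_iff_mem
  have hrange : Module.finrank F φ.range =
      Module.finrank F (A.carrier ⧸ stableCore f M.asIdeal) := by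
    rw [← hker]
    exact (Ideal.quotientKerEquivRange φ).toLinearEquiv.finrank_eq.symm
  obtain ⟨F', iF, -, finF, R, α, -, hα, hα', -, -, hdim⟩ :=
    A.exists_descent (E := A.carrier ⧸ M.asIdeal) F hf (fun t ht =>
      ⟨t 1, funext fun h => (congrFun (ht h) 1).symm.trans (congrArg t (one_mul h))⟩)
      (fun h c => rfl) φ hφ
  refine ⟨F', inferInstance, iF, finF, R, α, fun hdvd => hM ?_, hα, hα'⟩
  rw [← hrange, hdim]
  exact mul_dvd_mul_right hdvd _

/-- If a reduction `R` of `A` descends to `B` over `K`, then `A` descends to the algebra induced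
from `B`: over `E` both become the algebra induced from `E ⊗ R`. -/
theorem essDimAt_le_of_index {k : Type u} [Field k] (hf : Function.Injective f) {l : ℕ}
    (hlp : l.Prime) (hl : ¬ l * Fintype.card H ∣ Fintype.card G) :
    essDimAt k G l ≤ essDimAt k H l := by
  refine sSup_le ?_
  rintro _ ⟨F, iF, ikF, A, rfl⟩
  obtain ⟨F', iF', iFF', finF', R, α, hdeg, hα, hα'⟩ := A.exists_reduction hf hl
  let ikF' : Algebra k F' := ((algebraMap F F').comp (algebraMap k F)).toAlgebra
  have tF' : IsScalarTower k F F' := IsScalarTower.of_algebraMap_eq fun _ => rfl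
  refine le_trans ?_ (le_sSup ⟨F', iF', ikF', R, rfl⟩)
  refine le_sInf ?_
  rintro c ⟨E, iE, ikE, iFE, tE, hfin, hlE, K, B, ⟨e, he⟩, rfl⟩
  let iFE : Algebra F E := ((algebraMap F' E).comp (algebraMap F F')).toAlgebra
  have tFE : IsScalarTower F F' E := IsScalarTower.of_algebraMap_eq fun _ => rfl
  have tkFE : IsScalarTower k F E := IsScalarTower.of_algebraMap_eq fun c => by
    rw [IsScalarTower.algebraMap_apply k F' E]; rfl
  have := B.nontrivial
  have := R.nontrivial
  have := A.nontrivial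
  let P : GaloisAlgebra G K := (B.isGaloisAction.ind hf).toGaloisAlgebra
  have hdim : ¬ l ∣ Module.finrank F E := by
    rw [← Module.finrank_mul_finrank F F' E, hlp.dvd_mul]
    exact not_or.mpr ⟨hdeg, hlE⟩
  refine sInf_le ⟨E, iE, ikE, iFE, tkFE, Module.Finite.trans F' E, hdim, K, P, ?_, rfl⟩
  have hR := R.isGaloisAction.baseChange (E := E)
  have : SMulCommClass H E (E ⊗[F'] R.carrier) := ⟨fun h c x => smul_baseChange_smul h c x⟩
  have hI := hR.ind hf
  have hIE : ∀ (g : G) (c : E), g • algebraMap E (Ind f E (E ⊗[F'] R.carrier)) c =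
    algebraMap E _ c := fun g c => rfl
  let a : A.carrier →+* E ⊗[F'] R.carrier :=
    (Algebra.TensorProduct.includeRight : R.carrier →ₐ[F'] E ⊗[F'] R.carrier).toRingHom.comp α
  have ha : ∀ h x, a (f h • x) = h • a x := by
    intro h x
    change (1 : E) ⊗ₜ[F'] α (f h • x) = h • ((1 : E) ⊗ₜ[F'] α x)
    rw [hα', smul_baseChange_tmul]
  have ha' : ∀ c : F, a (algebraMap F _ c) = algebraMap E _ (algebraMap F E c) := by
    intro c
    change (1 : E) ⊗ₜ[F'] α (algebraMap F _ c) = _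
    rw [hα, one_tmul_algebraMap]
    rfl
  let b : P.carrier →+* E ⊗[F'] R.carrier :=
    (e.toRingEquiv.toRingHom.comp
      (Algebra.TensorProduct.includeRight : B.carrier →ₐ[K] E ⊗[K] B.carrier).toRingHom).comp
      (Ind.eval f K B.carrier).toRingHom
  have hb : ∀ h x, b (f h • x) = h • b x := by
    intro h x
    change e ((1 : E) ⊗ₜ[K] Ind.eval f K B.carrier (f h • x)) =
      h • e ((1 : E) ⊗ₜ[K] Ind.eval f K B.carrier x)
    refine (congrArg (fun y => e ((1 : E) ⊗ₜ[K] y))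
      (Ind.eval_smul (F := K) (R := B.carrier) h x)).trans ?_
    rw [← smul_baseChange_tmul, ← GaloisAlgebra.baseChangeAct_apply, he]
    rfl
  have hb' : ∀ c : K, b (algebraMap K _ c) = algebraMap E _ (algebraMap K E c) := by
    intro c
    change e ((1 : E) ⊗ₜ[K] algebraMap K B.carrier c) = _
    rw [one_tmul_algebraMap, e.commutes]
  obtain ⟨e₁, he₁⟩ := A.exists_baseChange_equiv hI (Ind.lift a ha)
    (fun c => Ind.ext fun g => by
      rw [Ind.lift_apply, smul_algebraMap]; exact ha' c)
    (Ind.lift_smul a ha) hIE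
  obtain ⟨e₂, he₂⟩ := P.exists_baseChange_equiv hI (Ind.lift b hb)
    (fun c => Ind.ext fun g => by
      rw [Ind.lift_apply, smul_algebraMap]; exact hb' c)
    (Ind.lift_smul b hb) hIE
  refine ⟨e₂.trans e₁.symm, fun g x => ?_⟩
  apply e₁.injective
  rw [he₁]
  simp [he₂]

end Index

/-! ### Dependence on the group only through its Sylow `l`-subgroup. -/

section Transport

universe w

variable {G : Type v} {G' : Type w} [Group G] [Group G']

lemma IsGaloisAction.compHom {F A : Type*} [CommRing F] [CommRing A] [Algebra F A]
    [MulSemiringAction G A] (hA : IsGaloisAction G F A) (e : G' ≃* G) :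
    letI := MulSemiringAction.compHom A e.toMonoidHom
    IsGaloisAction G' F A := by
  let _ := MulSemiringAction.compHom A e.toMonoidHom
  refine ⟨fun a ha => hA.mem_range a fun g => ?_, ?_⟩
  · obtain ⟨g, rfl⟩ := e.surjective g
    exact ha g
  · obtain ⟨ι, i, a, b, h1, h0⟩ := hA.exists_dual
    exact ⟨ι, i, a, b, h1, fun g hg => h0 (e g) (by simpa using hg)⟩

/-- Transport of a Galois algebra along an isomorphism of groups. -/
def GaloisAlgebra.transport [Fintype G] [Fintype G'] {F : Type u} [Field F]
    (A : GaloisAlgebra G F) (e : G' ≃* G) : GaloisAlgebra G' F :=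
  letI := MulSemiringAction.compHom A.carrier e.toMonoidHom
  haveI : SMulCommClass G' F A.carrier := ⟨fun g c x => smul_comm (e g) c x⟩
  haveI := A.nontrivial
  (A.isGaloisAction.compHom e).toGaloisAlgebra

lemma essDimAt_le_of_mulEquiv {k : Type u} [Field k] [Finite G] (e : G ≃* G') (l : ℕ) :
    essDimAt k G l ≤ essDimAt k G' l := by
  have := Fintype.ofFinite G
  have : Fintype G' := Fintype.ofEquiv G e.toEquiv
  refine sSup_le ?_
  rintro _ ⟨F, iF, ikF, A, rfl⟩
  refine le_trans ?_ (le_sSup ⟨F, iF, ikF, A.transport e.symm, rfl⟩)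
  refine le_sInf ?_
  rintro c ⟨E, iE, ikE, iFE, tE, hfin, hl, K, B, ⟨φ, hφ⟩, rfl⟩
  refine sInf_le ⟨E, iE, ikE, iFE, tE, hfin, hl, K, B.transport e, ⟨φ, fun g x => ?_⟩, rfl⟩
  refine (hφ (e g) x).trans ?_
  change baseChangeAct A E (e.symm (e g)) (φ x) = _
  rw [e.symm_apply_apply]
  rfl

/-- The essential dimension depends only on the isomorphism class of the group. -/
theorem essDimAt_congr {k : Type u} [Field k] [Finite G] (e : G ≃* G') (l : ℕ) :
    essDimAt k G l = essDimAt k G' l :=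
  have : Finite G' := Finite.of_equiv G e.toEquiv
  le_antisymm (essDimAt_le_of_mulEquiv e l) (essDimAt_le_of_mulEquiv e.symm l)

/-- A subgroup of index prime to `l` has the same essential `l`-dimension. -/
theorem essDimAt_eq_of_injective {k : Type u} [Field k] [Finite G] [Finite G'] {f : G' →* G}
    (hf : Function.Injective f) {l : ℕ} (hl : l.Prime) (h : ¬ l * Nat.card G' ∣ Nat.card G) :
    essDimAt k G' l = essDimAt k G l := by
  -- Induced algebras consist of functions on the group; replacing the groups by copies in `Type`
  -- keeps them in the universe of the fields.
  obtain ⟨H₀, _, _, ⟨eH⟩⟩ := Finite.exists_type_univ_nonempty_mulEquiv.{w, 0} G'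
  obtain ⟨G₀, _, _, ⟨eG⟩⟩ := Finite.exists_type_univ_nonempty_mulEquiv.{v, 0} G
  have := Fintype.ofFinite G₀
  have := Fintype.ofFinite H₀
  rw [essDimAt_congr eH, essDimAt_congr eG]
  let f₀ : H₀ →* G₀ := eG.toMonoidHom.comp (f.comp eH.symm.toMonoidHom)
  have hf₀ : Function.Injective f₀ := eG.injective.comp (hf.comp eH.symm.injective)
  refine le_antisymm (essDimAt_le_of_injective hf₀ l) (essDimAt_le_of_index hf₀ hl ?_)
  rwa [Nat.card_congr eH.toEquiv, Nat.card_congr eG.toEquiv, Nat.card_eq_fintype_card,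
    Nat.card_eq_fintype_card] at h

/-- Groups related by a homomorphism that induces an isomorphism of Sylow `l`-subgroups have the
same essential `l`-dimension. -/
theorem essDimAt_eq_of_hom {k : Type u} [Field k] [Finite G] [Finite G'] (f : G' →* G) {l : ℕ}
    (hl : l.Prime) (hker : ¬ l ∣ Nat.card f.ker)
    (h : (Nat.card G').factorization l = (Nat.card G).factorization l) :
    essDimAt k G' l = essDimAt k G l := by
  have : Fact l.Prime := ⟨hl⟩
  -- `P` meets the kernel trivially, so it embeds in `G` as well as in `G'`, with `l` not dividing
  -- the index in either.
  let P : Sylow l G' := default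
  have hP : Nat.card P = l ^ (Nat.card G').factorization l := P.card_eq_multiplicity
  have key : ∀ n, n ≠ 0 → (Nat.card G').factorization l = n.factorization l →
      ¬ l * Nat.card P ∣ n := by
    intro n hn hfac hdvd
    rw [hP, hfac, ← pow_succ'] at hdvd
    exact Nat.pow_succ_factorization_not_dvd hn hl hdvd
  have inj : Function.Injective (f.comp (P : Subgroup G').subtype) := by
    rw [injective_iff_map_eq_one]
    intro x hx
    have hx' : (x : G') ∈ f.ker := hx
    by_contra hne
    refine hker ((P.isPGroup'.dvd_orderOf hne).trans ?_)
    rw [← Subgroup.orderOf_coe, ← Subgroup.orderOf_mk _ hx']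
    exact orderOf_dvd_natCard _
  rw [← essDimAt_eq_of_injective (Subgroup.subtype_injective (P : Subgroup G')) hl
    (key _ Nat.card_pos.ne' rfl), ← essDimAt_eq_of_injective inj hl (key _ Nat.card_pos.ne' h)]

end Transport

end EssDim

namespace FiniteOrthogonal

open QuadraticMap

/-! ### Reflections and their transitivity on singular vectors. -/

section Isometries

variable {F : Type*} [Field F] {V : Type*} [AddCommGroup V] [Module F V]

instance [Finite V] : Finite (V ≃ₗ[F] V) :=
  Finite.of_injective (fun g => (g : V → V)) DFunLike.coe_injective

/-- The group of linear isometries of a quadratic form. -/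
def isom (Q : QuadraticForm F V) : Subgroup (V ≃ₗ[F] V) where
  carrier := {g | ∀ x, Q (g x) = Q x}
  one_mem' := fun _ => rfl
  mul_mem' := fun {g h} hg hh x => by rw [LinearEquiv.mul_apply, hg, hh]
  inv_mem' := fun {g} hg x => by
    rw [← hg, ← LinearEquiv.mul_apply, mul_inv_cancel]; rfl

variable {Q : QuadraticForm F V}

lemma mem_isom {g : V ≃ₗ[F] V} : g ∈ isom Q ↔ ∀ x, Q (g x) = Q x := Iff.rfl

lemma polar_of_mem_isom {g : V ≃ₗ[F] V} (hg : g ∈ isom Q) (x y : V) :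
    polar Q (g x) (g y) = polar Q x y := by
  simp only [polar, ← map_add, mem_isom.mp hg]

lemma map_add_smul (x y : V) (t : F) : Q (x + t • y) = Q x + t * polar Q x y + t * t * Q y := by
  rw [QuadraticMap.map_add Q, QuadraticMap.map_smul, polar_smul_right, smul_eq_mul, smul_eq_mul]
  ring

/-- The reflection in a nonsingular vector. -/
def reflEquiv (Q : QuadraticForm F V) (v : V) (hv : Q v ≠ 0) : V ≃ₗ[F] V :=
  -- Dividing by `Q v`, not by the value `2 * Q v` of the polar form, keeps the formula valid in
  -- characteristic two.
  Module.reflection (x := v) (f := (Q v)⁻¹ • Q.polarBilin v) (by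
    rw [LinearMap.smul_apply, polarBilin_apply_apply, polar_self, smul_eq_mul, nsmul_eq_mul]
    field_simp
    norm_num)

lemma reflEquiv_apply {v : V} (hv : Q v ≠ 0) (y : V) :
    reflEquiv Q v hv y = y - ((Q v)⁻¹ * polar Q v y) • v := by
  simp [reflEquiv, Module.reflection_apply]

lemma reflEquiv_mul_self {v : V} (hv : Q v ≠ 0) : reflEquiv Q v hv * reflEquiv Q v hv = 1 :=
  LinearEquiv.ext fun y => Module.involutive_reflection _ y

lemma reflEquiv_mem_isom {v : V} (hv : Q v ≠ 0) : reflEquiv Q v hv ∈ isom Q := fun y => by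
  rw [reflEquiv_apply, sub_eq_add_neg, ← neg_smul, map_add_smul, polar_comm Q y v]
  field_simp
  ring

/-- A reflection exchanges vectors of the same value and nonsingular difference. -/
lemma reflEquiv_sub_apply {x y : V} (h : Q x = Q y) (hv : Q (y - x) ≠ 0) :
    reflEquiv Q (y - x) hv x = y := by
  have key : polar Q (y - x) x = - Q (y - x) := by
    have h1 : Q (y - x) = Q y - polar Q y x + Q x := by
      have := map_add_smul (Q := Q) y x (-1)
      rw [neg_smul, one_smul, ← sub_eq_add_neg] at this
      rw [this]; ring
    rw [polar_sub_left, polar_self, h1, h]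
    simp only [nsmul_eq_mul]
    push_cast
    ring
  rw [reflEquiv_apply, key, mul_neg, inv_mul_cancel₀ hv, neg_smul, one_smul]
  abel

/-- The reflections of a quadratic space. -/
def reflections (Q : QuadraticForm F V) : Set (V ≃ₗ[F] V) :=
  {g | ∃ (v : V) (hv : Q v ≠ 0), g = reflEquiv Q v hv}

lemma closure_reflections_le : Subgroup.closure (reflections Q) ≤ isom Q := by
  rw [Subgroup.closure_le]
  rintro _ ⟨v, hv, rfl⟩
  exact reflEquiv_mem_isom hv

/-- The isometries of an anisotropic form are products of reflections. -/
theorem isom_le_closure_of_anisotropic [Finite V] (hQ : Q.Anisotropic) :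
    isom Q ≤ Subgroup.closure (reflections Q) := by
  intro g
  -- Induction on the number of moved vectors: following `g` by the reflection in `g x - x` makes
  -- `x` fixed and keeps the vectors fixed by `g`. Anisotropy makes `g x - x` nonsingular.
  induction hn : {y | g y ≠ y}.ncard using Nat.strong_induction_on generalizing g with
  | _ n ih =>
    intro hg
    by_cases h1 : g = 1
    · rw [h1]; exact one_mem _
    · obtain ⟨x, hx⟩ : ∃ x, g x ≠ x := by
        by_contra! h
        exact h1 (LinearEquiv.ext h)
      have hu : Q (g x - x) ≠ 0 := fun h => hx (sub_eq_zero.mp (hQ _ h))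
      have hr : reflEquiv Q (g x - x) hu ∈ Subgroup.closure (reflections Q) :=
        Subgroup.subset_closure ⟨_, hu, rfl⟩
      have hrx := reflEquiv_sub_apply (hg x).symm hu
      have hinv : ∀ y, reflEquiv Q (g x - x) hu (reflEquiv Q (g x - x) hu y) = y := fun y => by
        rw [← LinearEquiv.mul_apply, reflEquiv_mul_self]; rfl
      rw [← Subgroup.mul_mem_cancel_left _ hr]
      refine ih _ ?_ rfl (mul_mem (reflEquiv_mem_isom hu) hg)
      rw [← hn]
      refine Set.ncard_lt_ncard ?_ (Set.toFinite _)
      rw [Set.ssubset_iff_of_subset]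
      · refine ⟨x, hx, ?_⟩
        simp only [Set.mem_ofPred_eq, not_not, LinearEquiv.mul_apply]
        nth_rewrite 2 [← hrx]
        exact hinv x
      · intro y hy hgy
        apply hy
        rw [LinearEquiv.mul_apply, hgy, reflEquiv_apply, polar_sub_left]
        nth_rewrite 2 [← hgy]
        rw [polar_of_mem_isom hg, sub_self, mul_zero, zero_smul, sub_zero]

/-- The radical of the polar form contains no singular vectors. -/
def Regular (Q : QuadraticForm F V) : Prop :=
  ∀ x, (∀ y, polar Q x y = 0) → Q x = 0 → x = 0

/-- Reflections act transitively on the nonzero singular vectors. -/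
theorem exists_reflections_apply_eq (hQ : Regular Q) {x y : V} (hx : x ≠ 0) (hy : y ≠ 0)
    (hQx : Q x = 0) (hQy : Q y = 0) : ∃ g ∈ Subgroup.closure (reflections Q), g x = y := by
  -- Nonorthogonal singular vectors have a nonsingular difference, whose reflection exchanges them.
  have step : ∀ x y, Q x = 0 → Q y = 0 → polar Q x y ≠ 0 →
      ∃ g ∈ Subgroup.closure (reflections Q), g x = y := by
    intro x y hx hy hxy
    have hne : Q (y - x) ≠ 0 := by
      have := map_add_smul (Q := Q) y x (-1)
      rw [neg_smul, one_smul, ← sub_eq_add_neg] at this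
      rw [this, hx, hy, polar_comm]
      simpa using hxy
    exact ⟨_, Subgroup.subset_closure ⟨_, hne, rfl⟩, reflEquiv_sub_apply (hx.trans hy.symm) hne⟩
  by_cases hxy : polar Q x y = 0
  · have ex : ∀ x, x ≠ 0 → Q x = 0 → ∃ u, polar Q x u ≠ 0 := by
      intro x hx h0
      by_contra! h
      exact hx (hQ x h h0)
    -- Orthogonal vectors are joined through a third singular vector `z`. Two proper subspaces do
    -- not cover the space, so some `u` is orthogonal to neither; a multiple of `x` then makes it
    -- singular.
    obtain ⟨u, hxu, hyu⟩ : ∃ u, polar Q x u ≠ 0 ∧ polar Q y u ≠ 0 := by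
      obtain ⟨u₁, h₁⟩ := ex x hx hQx
      obtain ⟨u₂, h₂⟩ := ex y hy hQy
      by_cases h₃ : polar Q y u₁ = 0
      · by_cases h₄ : polar Q x u₂ = 0
        · exact ⟨u₁ + u₂, by rwa [polar_add_right, h₄, add_zero],
            by rwa [polar_add_right, h₃, zero_add]⟩
        · exact ⟨u₂, h₄, h₂⟩
      · exact ⟨u₁, h₁, h₃⟩
    let z := u + (-(Q u / polar Q x u)) • x
    have hz : Q z = 0 := by
      rw [map_add_smul, hQx, polar_comm Q u x]
      field_simp
      ring
    have hxz : polar Q x z ≠ 0 := by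
      rwa [polar_add_right, polar_smul_right, polar_self, hQx, smul_zero, smul_zero, add_zero]
    have hyz : polar Q z y ≠ 0 := by
      rwa [polar_comm, polar_add_right, polar_smul_right, polar_comm Q y x, hxy, smul_zero,
        add_zero]
    obtain ⟨g, hg, hgx⟩ := step x z hQx hz hxz
    obtain ⟨h, hh, hhz⟩ := step z y hz hQy hyz
    exact ⟨h * g, mul_mem hh hg, by rw [LinearEquiv.mul_apply, hgx, hhz]⟩
  · exact step x y hQx hQy hxy

end Isometries

/-! ### Hyperbolic extensions: Eichler transformations, generation, order, zeros. -/

section Hyperbolic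

variable {F : Type*} [Field F] {V : Type*} [AddCommGroup V] [Module F V]

/-- The orthogonal sum of a hyperbolic plane and `Q`. -/
def hyp (Q : QuadraticForm F V) : QuadraticForm F ((F × F) × V) :=
  linMulLin (LinearMap.fst F F F ∘ₗ LinearMap.fst F (F × F) V)
    (LinearMap.snd F F F ∘ₗ LinearMap.fst F (F × F) V) + Q.comp (LinearMap.snd F (F × F) V)

variable {Q : QuadraticForm F V}

lemma hyp_apply (x : (F × F) × V) : hyp Q x = x.1.1 * x.1.2 + Q x.2 := by
  simp [hyp]

lemma polar_hyp (x y : (F × F) × V) :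
    polar (hyp Q) x y = x.1.1 * y.1.2 + y.1.1 * x.1.2 + polar Q x.2 y.2 := by
  simp only [polar, hyp_apply, Prod.fst_add, Prod.snd_add]
  ring

lemma Regular.hyp (hQ : Regular Q) : Regular (hyp Q) := by
  rintro ⟨⟨a, b⟩, v⟩ hx h0
  have ha : a = 0 := by simpa [polar_hyp] using hx ((0, 1), 0)
  have hb : b = 0 := by simpa [polar_hyp] using hx ((1, 0), 0)
  subst ha hb
  have hv : v = 0 := hQ v (fun y => by simpa [polar_hyp] using hx ((0, 0), y))
    (by simpa [hyp_apply] using h0)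
  rw [hv]; rfl

/-- The underlying linear map of an Eichler transformation of the hyperbolic extension of `Q`. -/
def eichlerMap (Q : QuadraticForm F V) (v : V) : ((F × F) × V) →ₗ[F] ((F × F) × V) where
  toFun x := ((x.1.1 - polar Q v x.2 - Q v * x.1.2, x.1.2), x.2 + x.1.2 • v)
  map_add' x y := by
    simp only [Prod.fst_add, Prod.snd_add, polar_add_right, add_smul]
    refine Prod.ext (Prod.ext ?_ rfl) ?_
    · simp only [Prod.fst_add]; ring
    · simp only [Prod.snd_add]; abel
  map_smul' c x := by
    simp only [Prod.smul_fst, Prod.smul_snd, polar_smul_right, RingHom.id_apply, smul_eq_mul]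
    refine Prod.ext (Prod.ext ?_ rfl) ?_
    · simp only [Prod.smul_fst, smul_eq_mul]; ring
    · simp only [Prod.smul_snd, smul_add, mul_smul]

lemma eichlerMap_apply (Q : QuadraticForm F V) (v : V) (x : (F × F) × V) :
    eichlerMap Q v x = ((x.1.1 - polar Q v x.2 - Q v * x.1.2, x.1.2), x.2 + x.1.2 • v) := rfl

lemma eichlerMap_zero (Q : QuadraticForm F V) : eichlerMap Q 0 = LinearMap.id := by
  refine LinearMap.ext fun x => ?_
  simp [eichlerMap_apply]

lemma eichlerMap_add (Q : QuadraticForm F V) (v w : V) :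
    eichlerMap Q (v + w) = eichlerMap Q v ∘ₗ eichlerMap Q w := by
  refine LinearMap.ext fun x => ?_
  simp only [LinearMap.comp_apply, eichlerMap_apply, polar_add_left, polar_add_right,
    polar_smul_right, QuadraticMap.map_add Q v w, smul_eq_mul]
  refine Prod.ext (Prod.ext ?_ rfl) ?_
  · simp only; ring
  · simp only [smul_add]; abel

/-- The Eichler transformations of the hyperbolic extension of `Q`. -/
def eichler (Q : QuadraticForm F V) : Multiplicative V →* (((F × F) × V) ≃ₗ[F] ((F × F) × V)) where
  toFun v := LinearEquiv.ofLinearMap (eichlerMap Q v.toAdd) (eichlerMap Q (-v.toAdd))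
    (by rw [← eichlerMap_add, add_neg_cancel, eichlerMap_zero])
    (by rw [← eichlerMap_add, neg_add_cancel, eichlerMap_zero])
  map_one' := LinearEquiv.ext fun x => congrArg (· x) (eichlerMap_zero Q)
  map_mul' v w := LinearEquiv.ext fun x => congrArg (· x) (eichlerMap_add Q v.toAdd w.toAdd)

lemma eichler_apply (v : V) (x : (F × F) × V) : eichler Q (.ofAdd v) x =
    ((x.1.1 - polar Q v x.2 - Q v * x.1.2, x.1.2), x.2 + x.1.2 • v) := rfl

lemma eichler_mem_isom (v : Multiplicative V) : eichler Q v ∈ isom (hyp Q) := by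
  obtain ⟨v, rfl⟩ := Multiplicative.ofAdd.surjective v
  intro x
  rw [eichler_apply, hyp_apply, hyp_apply]
  simp only
  rw [map_add_smul, polar_comm Q v]
  ring

lemma eichler_pow_char (p : ℕ) [CharP F p] (v : Multiplicative V) : eichler Q v ^ p = 1 := by
  rw [← map_pow]
  have : v ^ p = 1 := by
    obtain ⟨v, rfl⟩ := Multiplicative.ofAdd.surjective v
    rw [← ofAdd_nsmul, ← Nat.cast_smul_eq_nsmul F, CharP.cast_eq_zero, zero_smul]
    rfl
  rw [this, map_one]

/-- Extension of a linear automorphism by the identity of the hyperbolic plane. -/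
def extHyp : (V ≃ₗ[F] V) →* (((F × F) × V) ≃ₗ[F] ((F × F) × V)) where
  toFun g := (LinearEquiv.refl F (F × F)).prodCongr g
  map_one' := rfl
  map_mul' _ _ := rfl

lemma extHyp_apply (g : V ≃ₗ[F] V) (x : (F × F) × V) : extHyp g x = (x.1, g x.2) := rfl

lemma extHyp_injective : Function.Injective (extHyp (F := F) (V := V)) := fun _ _ hgh =>
  LinearEquiv.ext fun x => congrArg Prod.snd (LinearEquiv.congr_fun hgh ((0, 0), x))

lemma extHyp_mem_isom {g : V ≃ₗ[F] V} (hg : g ∈ isom Q) : extHyp g ∈ isom (hyp Q) := fun x => by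
  rw [extHyp_apply, hyp_apply, hyp_apply, mem_isom.mp hg]

/-- An isometry of the hyperbolic extension fixing the hyperbolic pair comes from `Q`. -/
lemma exists_extHyp_eq {g : ((F × F) × V) ≃ₗ[F] ((F × F) × V)} (hg : g ∈ isom (hyp Q))
    (he : g ((1, 0), 0) = ((1, 0), 0)) (hf : g ((0, 1), 0) = ((0, 1), 0)) :
    ∃ h ∈ isom Q, extHyp h = g := by
  -- Orthogonality to the fixed hyperbolic pair kills the hyperbolic coordinates of images of `V`.
  have key : ∀ k ∈ isom (hyp Q), k ((1, 0), 0) = ((1, 0), 0) → k ((0, 1), 0) = ((0, 1), 0) →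
      ∀ v, (k ((0, 0), v)).1 = (0, 0) := by
    intro k hk he hf v
    have h1 := polar_of_mem_isom hk ((1, 0), 0) ((0, 0), v)
    have h2 := polar_of_mem_isom hk ((0, 1), 0) ((0, 0), v)
    rw [he] at h1
    rw [hf] at h2
    simp only [polar_hyp, polar_zero_left] at h1 h2
    refine Prod.ext ?_ ?_
    · simpa using h2
    · simpa using h1
  have hinv : ∀ x, g x = x → g⁻¹ x = x := fun x hx => by
    nth_rewrite 1 [← hx]
    rw [← LinearEquiv.mul_apply, inv_mul_cancel]; rfl
  have k1 := key g hg he hf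
  have k2 := key g⁻¹ (inv_mem hg) (hinv _ he) (hinv _ hf)
  have e1 : ∀ v, g ((0, 0), v) = ((0, 0), (g ((0, 0), v)).2) := fun v => Prod.ext (k1 v) rfl
  have e2 : ∀ v, g⁻¹ ((0, 0), v) = ((0, 0), (g⁻¹ ((0, 0), v)).2) := fun v => Prod.ext (k2 v) rfl
  let i : V →ₗ[F] (F × F) × V := LinearMap.inr F (F × F) V
  let s : (F × F) × V →ₗ[F] V := LinearMap.snd F (F × F) V
  let h : V ≃ₗ[F] V := LinearEquiv.ofLinearMap (s ∘ₗ g.toLinearMap ∘ₗ i)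
    (s ∘ₗ (g⁻¹).toLinearMap ∘ₗ i)
    (LinearMap.ext fun v => by
      change (g ((0, 0), (g⁻¹ ((0, 0), v)).2)).2 = v
      rw [← e2, ← LinearEquiv.mul_apply, mul_inv_cancel]; rfl)
    (LinearMap.ext fun v => by
      change (g⁻¹ ((0, 0), (g ((0, 0), v)).2)).2 = v
      rw [← e1, ← LinearEquiv.mul_apply, inv_mul_cancel]; rfl)
  have hh : ∀ v, g ((0, 0), v) = ((0, 0), h v) := e1
  refine ⟨h, fun v => ?_, LinearEquiv.ext fun x => ?_⟩
  · have := hg ((0, 0), v)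
    rw [hh, hyp_apply, hyp_apply] at this
    simpa using this
  · obtain ⟨⟨a, b⟩, v⟩ := x
    have : (((a, b), v) : (F × F) × V) =
        a • ((1, 0), 0) + b • ((0, 1), 0) + ((0, 0), v) := by simp
    rw [extHyp_apply]
    nth_rewrite 3 [this]
    rw [map_add, map_add, map_smul, map_smul, he, hf, hh]
    simp

/-- Factorization of an isometry fixing the first vector of the hyperbolic pair. -/
lemma exists_eichler_mul_extHyp {g : ((F × F) × V) ≃ₗ[F] ((F × F) × V)} (hg : g ∈ isom (hyp Q))
    (he : g ((1, 0), 0) = ((1, 0), 0)) :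
    ∃ v, ∃ h ∈ isom Q, g = eichler Q v * extHyp h := by
  let v := (g ((0, 1), 0)).2
  -- Pairing with the fixed vector and singularity determine this image from its component `v`, so
  -- the Eichler transformation of `v` agrees with `g` on the whole pair.
  have hf : g ((0, 1), 0) = ((- Q v, 1), v) := by
    have h1 := polar_of_mem_isom hg ((1, 0), 0) ((0, 1), 0)
    have h2 := hg ((0, 1), 0)
    rw [he] at h1
    have h3 : (g ((0, 1), 0)).1.2 = 1 := by simpa [polar_hyp] using h1
    refine Prod.ext (Prod.ext ?_ h3) rfl
    rw [hyp_apply, hyp_apply, h3] at h2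
    simp only [mul_one, QuadraticMap.map_zero, add_zero] at h2
    exact eq_neg_of_add_eq_zero_left h2
  have hEe : eichler Q (.ofAdd v) ((1, 0), 0) = ((1, 0), 0) := by simp [eichler_apply]
  have hEf : eichler Q (.ofAdd v) ((0, 1), 0) = ((- Q v, 1), v) := by simp [eichler_apply]
  have hinv : ∀ x y, eichler Q (.ofAdd v) x = y → (eichler Q (.ofAdd v))⁻¹ y = x := by
    rintro x _ rfl
    rw [← LinearEquiv.mul_apply, inv_mul_cancel]; rfl
  obtain ⟨h, hh, hgh⟩ := exists_extHyp_eq (mul_mem (inv_mem (eichler_mem_isom (.ofAdd v))) hg)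
    (by rw [LinearEquiv.mul_apply, he, hinv _ _ hEe])
    (by rw [LinearEquiv.mul_apply, hf, hinv _ _ hEf])
  exact ⟨.ofAdd v, h, hh, by rw [hgh, mul_inv_cancel_left]⟩

/-- The isometry group is generated by reflections and elements of order `p`. -/
def GeneratedBy (p : ℕ) (Q : QuadraticForm F V) : Prop :=
  isom Q ≤ Subgroup.closure (reflections Q ∪ {g | g ∈ isom Q ∧ g ^ p = 1})

/-- Reflections carry the first vector of the hyperbolic pair to its image under `g`; the remaining
factor fixes that vector. -/
lemma exists_mul_eichler_mul_extHyp (hQ : Regular Q)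
    {g : ((F × F) × V) ≃ₗ[F] ((F × F) × V)} (hg : g ∈ isom (hyp Q)) :
    ∃ r ∈ Subgroup.closure (reflections (hyp Q)), ∃ v, ∃ h ∈ isom Q,
      g = r * eichler Q v * extHyp h := by
  obtain ⟨r, hr, hre⟩ := exists_reflections_apply_eq hQ.hyp (x := ((1, 0), 0))
    (y := g ((1, 0), 0)) (by simp) (by simp) (by simp [hyp_apply])
    (by rw [mem_isom.mp hg]; simp [hyp_apply])
  obtain ⟨v, h, hh, hgh⟩ := exists_eichler_mul_extHyp
    (mul_mem (inv_mem (closure_reflections_le hr)) hg)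
    (by rw [LinearEquiv.mul_apply, ← hre, ← LinearEquiv.mul_apply, inv_mul_cancel]; rfl)
  exact ⟨r, hr, v, h, hh, by rw [mul_assoc, ← hgh, mul_inv_cancel_left]⟩

/-- Eichler transformations are killed by `p`, and extension by the identity takes reflections to
reflections. -/
theorem GeneratedBy.hyp {p : ℕ} [CharP F p] (hQ : Regular Q) (h : GeneratedBy p Q) :
    GeneratedBy p (hyp Q) := by
  intro g hg
  obtain ⟨r, hr, v, k, hk, rfl⟩ := exists_mul_eichler_mul_extHyp hQ hg
  refine mul_mem (mul_mem (Subgroup.closure_mono Set.subset_union_left hr)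
    (Subgroup.subset_closure (Or.inr ⟨eichler_mem_isom v, eichler_pow_char p v⟩))) ?_
  rw [← Subgroup.mem_comap]
  refine (Subgroup.closure_le _).mpr ?_ (h hk)
  rintro _ (⟨u, hu, rfl⟩ | ⟨hg, hp⟩)
  · have hu' : FiniteOrthogonal.hyp Q ((0, 0), u) ≠ 0 := by simpa [hyp_apply] using hu
    refine Subgroup.subset_closure (Or.inl ⟨((0, 0), u), hu', LinearEquiv.ext fun x => ?_⟩)
    rw [extHyp_apply, reflEquiv_apply, reflEquiv_apply]
    simp [hyp_apply, polar_hyp, Prod.ext_iff]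
  · exact Subgroup.subset_closure (Or.inr ⟨extHyp_mem_isom hg, by rw [← map_pow, hp, map_one]⟩)

/-- The order of the isometry group of a hyperbolic extension. -/
theorem card_isom_hyp (hQ : Regular Q) : Nat.card (isom (hyp Q)) =
    Nat.card {x : (F × F) × V // x ≠ 0 ∧ hyp Q x = 0} * Nat.card V * Nat.card (isom Q) := by
  have ex : ∀ x : {x : (F × F) × V // x ≠ 0 ∧ hyp Q x = 0}, ∃ g ∈ isom (hyp Q),
      g ((1, 0), 0) = x.1 := fun x => by
    obtain ⟨r, hr, hre⟩ := exists_reflections_apply_eq hQ.hyp (x := ((1, 0), 0))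
      (y := x.1) (by simp) x.2.1 (by simp [hyp_apply]) x.2.2
    exact ⟨r, closure_reflections_le hr, hre⟩
  choose ρ hρ hρe using ex
  -- Orbit and stabilizer made explicit: the coordinates are the image of the first hyperbolic
  -- vector, the Eichler parameter and the isometry of `Q`.
  let T : ({x : (F × F) × V // x ≠ 0 ∧ hyp Q x = 0} × V) × isom Q → isom (hyp Q) := fun y =>
    ⟨ρ y.1.1 * eichler Q (.ofAdd y.1.2) * extHyp y.2.1,
      mul_mem (mul_mem (hρ _) (eichler_mem_isom _)) (extHyp_mem_isom y.2.2)⟩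
  have hT : Function.Bijective T := by
    constructor
    · rintro ⟨⟨x, v⟩, h⟩ ⟨⟨x', v'⟩, h'⟩ heq
      have heq := congrArg Subtype.val heq
      simp only [T] at heq
      have hx : x = x' := by
        have := LinearEquiv.congr_fun heq ((1, 0), 0)
        simp only [LinearEquiv.mul_apply, extHyp_apply, map_zero, eichler_apply] at this
        simpa [hρe, Subtype.ext_iff] using this
      subst hx
      rw [mul_assoc, mul_assoc] at heq
      have heq := mul_left_cancel heq
      have hv : v = v' := by
        have := LinearEquiv.congr_fun heq ((0, 1), 0)
        simp only [LinearEquiv.mul_apply, extHyp_apply, map_zero, eichler_apply] at this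
        simpa using congrArg Prod.snd this
      subst hv
      rw [Subtype.ext (extHyp_injective (mul_left_cancel heq))]
    · rintro ⟨g, hg⟩
      let x : {x : (F × F) × V // x ≠ 0 ∧ hyp Q x = 0} :=
        ⟨g ((1, 0), 0), by simp, by rw [mem_isom.mp hg]; simp [hyp_apply]⟩
      obtain ⟨v, h, hh, hgh⟩ := exists_eichler_mul_extHyp
        (mul_mem (inv_mem (hρ x)) hg) (by
          rw [LinearEquiv.mul_apply]
          change (ρ x)⁻¹ x.1 = _
          rw [← hρe x, ← LinearEquiv.mul_apply, inv_mul_cancel]; rfl)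
      refine ⟨((x, v.toAdd), ⟨h, hh⟩), Subtype.ext ?_⟩
      simp only [T, ofAdd_toAdd]
      rw [mul_assoc, ← hgh, mul_inv_cancel_left]
  rw [← Nat.card_congr (Equiv.ofBijective T hT), Nat.card_prod, Nat.card_prod]

/-- The number of zeros of a hyperbolic extension. -/
theorem card_zeros_hyp [Finite F] [Finite V] : Nat.card {x : (F × F) × V // hyp Q x = 0} =
    (Nat.card F - 1) * Nat.card V + Nat.card F * Nat.card {v : V // Q v = 0} := by
  classical
  -- A nonzero first coordinate determines the second; if the first is zero, the second is free and
  -- the `V`-component is a zero of `Q`.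
  let S : ({a : F // a ≠ 0} × V) ⊕ (F × {v : V // Q v = 0}) → {x : (F × F) × V // hyp Q x = 0} :=
    Sum.elim (fun y => ⟨((y.1, - Q y.2 / y.1), y.2), by
        have := y.1.2
        rw [hyp_apply]; field_simp; ring⟩)
      (fun y => ⟨((0, y.1), y.2), by rw [hyp_apply, y.2.2]; simp⟩)
  have hS : Function.Bijective S := by
    constructor
    · rintro (⟨a, v⟩ | ⟨b, v⟩) (⟨a', v'⟩ | ⟨b', v'⟩) h
      · simp only [S, Sum.elim_inl, Subtype.mk.injEq, Prod.mk.injEq] at h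
        rw [Subtype.ext h.1.1, h.2]
      · simp only [S, Sum.elim_inl, Sum.elim_inr, Subtype.mk.injEq, Prod.mk.injEq] at h
        exact absurd h.1.1 a.2
      · simp only [S, Sum.elim_inl, Sum.elim_inr, Subtype.mk.injEq, Prod.mk.injEq] at h
        exact absurd h.1.1.symm a'.2
      · simp only [S, Sum.elim_inr, Subtype.mk.injEq, Prod.mk.injEq] at h
        rw [h.1.2, Subtype.ext h.2]
    · rintro ⟨⟨⟨a, b⟩, v⟩, h⟩
      rw [hyp_apply] at h
      simp only at h
      by_cases ha : a = 0
      · subst ha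
        exact ⟨.inr (b, ⟨v, by simpa using h⟩), rfl⟩
      · refine ⟨.inl (⟨a, ha⟩, v), ?_⟩
        simp only [S, Sum.elim_inl, Subtype.mk.injEq, Prod.mk.injEq, true_and, and_true]
        rw [div_eq_iff ha]
        linear_combination -h
  have hF : Nat.card {a : F // a ≠ 0} = Nat.card F - 1 := by
    have := Fintype.ofFinite F
    rw [Nat.card_eq_fintype_card, Nat.card_eq_fintype_card, Fintype.card_subtype_compl,
      Fintype.card_subtype_eq]
  rw [← Nat.card_congr (Equiv.ofBijective S hS), Nat.card_sum, Nat.card_prod, Nat.card_prod, hF]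

end Hyperbolic

/-! ### Invariance under isometry. -/

section Transport

variable {F : Type*} [Field F] {V W : Type*} [AddCommGroup V] [Module F V] [AddCommGroup W]
  [Module F W] {Q : QuadraticForm F V} {R : QuadraticForm F W}

lemma card_ne_zero_zeros (Q : QuadraticForm F V) [Finite V] :
    Nat.card {x // x ≠ 0 ∧ Q x = 0} + 1 = Nat.card {x // Q x = 0} := by
  classical
  have := Fintype.ofFinite V
  have h0 : Nat.card {x // x ≠ 0 ∧ Q x = 0} = 
      ((Finset.univ.filter fun x => Q x = 0).erase 0).card := by
    rw [Nat.card_eq_fintype_card]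
    refine Fintype.card_of_subtype _ fun x => ?_
    simp
  rw [h0, Finset.card_erase_add_one (by simp), Nat.card_eq_fintype_card]
  exact (Fintype.card_subtype _).symm

/-- Isometric spaces have isomorphic isometry groups. -/
def isomCongr (e : Q.IsometryEquiv R) : isom Q ≃* isom R where
  toFun g := ⟨e.toLinearEquiv.symm.trans (g.1.trans e.toLinearEquiv), fun x => by
    have h1 : ∀ y, R (e.toLinearEquiv y) = Q y := e.map_app
    simp only [LinearEquiv.trans_apply]
    rw [h1, g.2, ← h1, LinearEquiv.apply_symm_apply]⟩
  invFun g := ⟨e.toLinearEquiv.trans (g.1.trans e.toLinearEquiv.symm), fun x => by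
    have h1 : ∀ y, R (e.toLinearEquiv y) = Q y := e.map_app
    simp only [LinearEquiv.trans_apply]
    rw [← h1, LinearEquiv.apply_symm_apply, g.2, h1]⟩
  left_inv g := Subtype.ext (LinearEquiv.ext fun x => by simp)
  right_inv g := Subtype.ext (LinearEquiv.ext fun x => by simp)
  map_mul' g h := Subtype.ext (LinearEquiv.ext fun x => by simp [LinearEquiv.mul_apply])

lemma polar_isometryEquiv (e : Q.IsometryEquiv R) (x y : V) :
    polar R (e x) (e y) = polar Q x y := by
  simp only [polar, ← map_add, e.map_app]

lemma Regular.of_isometryEquiv (h : Regular R) (e : Q.IsometryEquiv R) : Regular Q := by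
  intro x hx h0
  have := h (e x) (fun y => by
    obtain ⟨y, rfl⟩ : ∃ z, e z = y := EquivLike.surjective e y
    rw [polar_isometryEquiv, hx]) (by rw [e.map_app, h0])
  exact e.injective (this.trans (map_zero e).symm)

lemma card_zeros_congr (e : Q.IsometryEquiv R) :
    Nat.card {x // Q x = 0} = Nat.card {x // R x = 0} :=
  Nat.card_congr (e.toLinearEquiv.toEquiv.subtypeEquiv fun x => by
    change _ ↔ R (e x) = 0
    rw [e.map_app])

lemma GeneratedBy.of_isometryEquiv {p : ℕ} (h : GeneratedBy p R) (e : Q.IsometryEquiv R) :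
    GeneratedBy p Q := by
  let c : (W ≃ₗ[F] W) →* (V ≃ₗ[F] V) :=
    { toFun := fun g => e.toLinearEquiv.trans (g.trans e.toLinearEquiv.symm)
      map_one' := LinearEquiv.ext fun x => by simp
      map_mul' := fun g h => LinearEquiv.ext fun x => by simp [LinearEquiv.mul_apply] }
  intro g hg
  have hgc : c (isomCongr e ⟨g, hg⟩).1 = g := LinearEquiv.ext fun x => by
    change e.toLinearEquiv.symm (e.toLinearEquiv (g (e.toLinearEquiv.symm (e.toLinearEquiv x)))) = _
    simp
  rw [← hgc, ← Subgroup.mem_comap]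
  refine (Subgroup.closure_le _).mpr ?_ (h (isomCongr e ⟨g, hg⟩).2)
  rintro k (⟨u, hu, rfl⟩ | ⟨hk, hp⟩)
  · obtain ⟨u, rfl⟩ : ∃ z, e z = u := EquivLike.surjective e u
    have hu' : Q u ≠ 0 := by rwa [e.map_app] at hu
    refine Subgroup.subset_closure (Or.inl ⟨u, hu', LinearEquiv.ext fun x => ?_⟩)
    change e.toLinearEquiv.symm (reflEquiv R (e u) hu (e x)) = _
    rw [reflEquiv_apply, reflEquiv_apply, polar_isometryEquiv, e.map_app]
    apply e.toLinearEquiv.injective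
    rw [LinearEquiv.apply_symm_apply, map_sub, map_smul]
    rfl
  · refine Subgroup.subset_closure (Or.inr ⟨?_, by rw [← map_pow, hp, map_one]⟩)
    exact ((isomCongr e).symm ⟨k, hk⟩).2

end Transport

/-! ### The forms of the theorem as iterated hyperbolic extensions. -/

section Forms

variable {F : Type*} [Field F]

lemma plusForm_apply (m : ℕ) (x : Fin m ⊕ Fin m → F) :
    plusForm F m x = ∑ i, x (.inl i) * x (.inr i) := by
  simp [plusForm]

lemma addPlusForm_apply {a : ℕ} (N : QuadraticForm F (Fin a → F)) (m : ℕ)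
    (x : Fin a ⊕ (Fin m ⊕ Fin m) → F) :
    addPlusForm N m x = N (fun i => x (.inl i)) +
      ∑ i, x (.inr (.inl i)) * x (.inr (.inr i)) := by
  simp only [addPlusForm, _root_.add_apply, QuadraticMap.comp_apply, plusForm_apply]
  rfl

/-- Splitting off the first hyperbolic plane. -/
def addPlusFormSucc {a : ℕ} (N : QuadraticForm F (Fin a → F)) (m : ℕ) :
    (addPlusForm N (m + 1)).IsometryEquiv (hyp (addPlusForm N m)) where
  toFun x := ((x (.inr (.inl 0)), x (.inr (.inr 0))),
    Sum.elim (fun i => x (.inl i)) (Sum.elim (fun i => x (.inr (.inl i.succ)))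
      (fun i => x (.inr (.inr i.succ)))))
  invFun y := Sum.elim (fun i => y.2 (.inl i)) (Sum.elim
    (Fin.cons y.1.1 fun i => y.2 (.inr (.inl i))) (Fin.cons y.1.2 fun i => y.2 (.inr (.inr i))))
  map_add' x y := by
    refine Prod.ext rfl (funext ?_)
    rintro (i | i | i) <;> rfl
  map_smul' c x := by
    refine Prod.ext rfl (funext ?_)
    rintro (i | i | i) <;> rfl
  left_inv x := by
    funext i
    rcases i with i | i | i
    · rfl
    · refine Fin.cases ?_ (fun i => ?_) i <;> rfl
    · refine Fin.cases ?_ (fun i => ?_) i <;> rfl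
  right_inv y := by
    refine Prod.ext rfl (funext ?_)
    rintro (i | i | i) <;> rfl
  map_app' x := by
    rw [hyp_apply, addPlusForm_apply, addPlusForm_apply, Fin.sum_univ_succ]
    simp only [Sum.elim_inl, Sum.elim_inr]
    ring

/-- No hyperbolic planes. -/
def addPlusFormZero {a : ℕ} (N : QuadraticForm F (Fin a → F)) :
    (addPlusForm N 0).IsometryEquiv N where
  toFun x i := x (.inl i)
  invFun y := Sum.elim y (Sum.elim Fin.elim0 Fin.elim0)
  map_add' x y := rfl
  map_smul' c x := rfl
  left_inv x := by
    funext i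
    rcases i with i | i | i
    · rfl
    · exact i.elim0
    · exact i.elim0
  right_inv y := rfl
  map_app' x := by simp [addPlusForm_apply]

/-- The split form as an orthogonal sum with the form in no variables. -/
def plusFormEquiv (m : ℕ) :
    (plusForm F m).IsometryEquiv (addPlusForm (0 : QuadraticForm F (Fin 0 → F)) m) where
  toFun x := Sum.elim Fin.elim0 x
  invFun y i := y (.inr i)
  map_add' x y := by
    funext i
    rcases i with i | i
    · exact i.elim0
    · rfl
  map_smul' c x := by
    funext i
    rcases i with i | i
    · exact i.elim0
    · rfl
  left_inv x := rfl
  right_inv y := by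
    funext i
    rcases i with i | i
    · exact i.elim0
    · rfl
  map_app' x := by simp [addPlusForm_apply, plusForm_apply]

variable {a : ℕ} {N : QuadraticForm F (Fin a → F)}

lemma regular_addPlusForm (hN : N.Anisotropic) (m : ℕ) : Regular (addPlusForm N m) := by
  induction m with
  | zero =>
    exact Regular.of_isometryEquiv (fun x _ h => hN x h) (addPlusFormZero N)
  | succ m ih => exact ih.hyp.of_isometryEquiv (addPlusFormSucc N m)

lemma generatedBy_addPlusForm [Finite F] (p : ℕ) [CharP F p] (hN : N.Anisotropic) (m : ℕ) :
    GeneratedBy p (addPlusForm N m) := by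
  induction m with
  | zero =>
    refine GeneratedBy.of_isometryEquiv (fun g hg => ?_) (addPlusFormZero N)
    exact Subgroup.closure_mono Set.subset_union_left (isom_le_closure_of_anisotropic hN hg)
  | succ m ih =>
    exact (GeneratedBy.hyp (regular_addPlusForm hN m) ih).of_isometryEquiv (addPlusFormSucc N m)

lemma card_zeros_addPlusForm_zero (hN : N.Anisotropic) :
    Nat.card {x // addPlusForm N 0 x = 0} = 1 := by
  rw [card_zeros_congr (addPlusFormZero N), Nat.card_eq_one_iff_unique]
  exact ⟨⟨fun x y => Subtype.ext ((hN _ x.2).trans (hN _ y.2).symm)⟩, ⟨0, QuadraticMap.map_zero N⟩⟩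

lemma card_space {F : Type*} [Finite F] (a m : ℕ) :
    Nat.card (Fin a ⊕ (Fin m ⊕ Fin m) → F) = Nat.card F ^ (a + 2 * m) := by
  rw [Nat.card_fun]
  simp [two_mul]

lemma card_zeros_addPlusForm_succ [Finite F] (m : ℕ) :
    Nat.card {x // addPlusForm N (m + 1) x = 0} = (Nat.card F - 1) * Nat.card F ^ (a + 2 * m) +
      Nat.card F * Nat.card {x // addPlusForm N m x = 0} := by
  rw [card_zeros_congr (addPlusFormSucc N m), card_zeros_hyp, card_space]

lemma card_isom_addPlusForm_succ [Finite F] (hN : N.Anisotropic) (m : ℕ) :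
    Nat.card (isom (addPlusForm N (m + 1))) =
      (Nat.card {x // addPlusForm N (m + 1) x = 0} - 1) * Nat.card F ^ (a + 2 * m) *
        Nat.card (isom (addPlusForm N m)) := by
  rw [Nat.card_congr (isomCongr (addPlusFormSucc N m)).toEquiv,
    card_isom_hyp (regular_addPlusForm hN m), card_space, card_zeros_congr (addPlusFormSucc N m),
    ← card_ne_zero_zeros, Nat.add_sub_cancel]

end Forms

/-! ### Isometries of anisotropic forms in one and two variables. -/

section Anisotropic

lemma not_dvd_card_of_mul_self {G : Type*} [Group G] [Finite G] {l : ℕ} (hl : l.Prime)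
    (hl2 : l ≠ 2) (h : ∀ g : G, g * g = 1) : ¬ l ∣ Nat.card G := by
  intro hdvd
  have : Fact l.Prime := ⟨hl⟩
  obtain ⟨g, hg⟩ := exists_prime_orderOf_dvd_card' l hdvd
  have h2 : l ∣ 2 := by
    rw [← hg]
    exact orderOf_dvd_of_pow_eq_one (by rw [pow_two, h])
  exact hl2 ((Nat.prime_dvd_prime_iff_eq hl Nat.prime_two).mp h2)

variable {F : Type*} [Field F]

lemma isom_unary_mul_self {c : F} (hc : c ≠ 0)
    (g : isom (c • QuadraticMap.proj (R := F) (A := F) (n := Fin 1) 0 0)) : g * g = 1 := by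
  refine Subtype.ext (LinearEquiv.ext fun x => ?_)
  have hx : ∀ x : Fin 1 → F, x = x 0 • (fun _ => 1) := fun x => by
    funext i; simp [Subsingleton.elim i 0]
  set t := g.1 (fun _ => 1) 0 with ht
  have hg : ∀ x, g.1 x = t • x := fun x => by
    conv_lhs => rw [hx x]
    conv_rhs => rw [hx x]
    rw [map_smul, hx (g.1 fun _ => 1), ← ht, smul_comm]
  have ht2 : t * t = 1 := by
    have := g.2 (fun _ => 1)
    rw [hg] at this
    have h2 : c * (t * t) = c * 1 := by simpa using this
    exact mul_left_cancel₀ hc h2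
  change g.1 (g.1 x) = x
  rw [hg, hg, smul_smul, ht2, one_smul]

variable {N : QuadraticForm F (Fin 2 → F)}

/-- The polar form of an anisotropic binary form over a finite field has no radical. -/
lemma exists_polar_ne_zero [Finite F] (hN : N.Anisotropic) {v : Fin 2 → F} (hv : v ≠ 0) :
    ∃ w, polar N v w ≠ 0 := by
  by_contra! h
  have hNv : N v ≠ 0 := fun h0 => hv (hN v h0)
  by_cases h2 : (2 : F) = 0
  · have : CharP F 2 := CharTwo.of_one_ne_zero_of_two_eq_zero one_ne_zero h2
    obtain ⟨w, hw⟩ : ∃ w : Fin 2 → F, ∀ t : F, t • v ≠ w := by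
      by_contra! hall
      have h1 : Module.finrank F (Fin 2 → F) ≤ 1 := finrank_le_one v hall
      simp at h1
    have hw0 : w ≠ 0 := fun h0 => hw 0 (by rw [h0, zero_smul])
    have hNw : N w ≠ 0 := fun h0 => hw0 (hN w h0)
    -- If `v` is in the radical, then `N (w + s • v) = N w + s ^ 2 * N v`. Choosing `s` with square
    -- `N w / N v` produces a zero, so `w` would lie on the line of `v`.
    have hsq : ∀ a : F, IsSquare a := FiniteField.isSquare_of_char_two (ringChar.eq F 2)
    obtain ⟨s, hs⟩ := hsq (N w / N v)
    refine hw (-s) ?_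
    have : w + s • v = 0 := by
      refine hN _ ?_
      rw [map_add_smul, polar_comm, h w, ← hs]
      field_simp
      linear_combination (N w) * h2
    rw [neg_smul, eq_neg_of_add_eq_zero_left this]
  · have := h v
    rw [polar_self, nsmul_eq_mul] at this
    exact (mul_ne_zero (by exact_mod_cast h2) hNv) this

/-- Representatives of the points of the projective line. -/
def lineRep : Option F → Fin 2 → F
  | none => ![1, 0]
  | some t => ![t, 1]

lemma lineRep_ne_zero (o : Option F) : lineRep o ≠ 0 := by
  cases o with
  | none => exact fun h => one_ne_zero (congrFun h 0)
  | some t => exact fun h => one_ne_zero (congrFun h 1)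

lemma exists_smul_lineRep (x : Fin 2 → F) : ∃ (o : Option F) (s : F), x = s • lineRep o := by
  by_cases h : x 1 = 0
  · refine ⟨none, x 0, funext fun i => ?_⟩
    fin_cases i <;> simp [lineRep, h]
  · refine ⟨some (x 0 / x 1), x 1, funext fun i => ?_⟩
    fin_cases i
    · simp [lineRep]; field_simp
    · simp [lineRep]

lemma eq_of_smul_lineRep_eq {o o' : Option F} {s s' : F} (h : s • lineRep o = s' • lineRep o')
    (hs : s ≠ 0) : o = o' := by
  have h0 := congrFun h 0
  have h1 := congrFun h 1
  cases o <;> cases o' <;> simp [lineRep] at h0 h1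
  · rfl
  · simp [← h1, hs] at h0
  · exact absurd h1 hs
  · subst h1
    rw [mul_left_cancel₀ hs h0]

/-- Pairing with `v` is a nonzero functional on a plane, so its kernel is a single line. -/
lemma eq_of_polar_lineRep_eq_zero [Finite F] (hN : N.Anisotropic) {v : Fin 2 → F} (hv : v ≠ 0)
    {o o' : Option F} (h : polar N v (lineRep o) = 0) (h' : polar N v (lineRep o') = 0) :
    o = o' := by
  have key : ∀ x : Fin 2 → F, polar N v x = x 0 * polar N v ![1, 0] + x 1 * polar N v ![0, 1] := by
    intro x
    have hx : x = x 0 • ![1, 0] + x 1 • ![0, 1] := by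
      funext i; fin_cases i <;> simp
    conv_lhs => rw [hx]
    rw [polar_add_right, polar_smul_right, polar_smul_right, smul_eq_mul, smul_eq_mul]
  obtain ⟨w, hw⟩ := exists_polar_ne_zero hN hv
  rw [key] at h h' hw
  cases o <;> cases o' <;> simp [lineRep] at h h'
  · rfl
  · rw [h, mul_zero, zero_add] at h'
    simp [h, h'] at hw
  · rw [h', mul_zero, zero_add] at h
    simp [h, h'] at hw
  · rename_i t t'
    have h3 : (t - t') * polar N v ![1, 0] = 0 := by linear_combination h - h'
    rcases mul_eq_zero.mp h3 with h4 | h4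
    · rw [sub_eq_zero.mp h4]
    · rw [h4, mul_zero, zero_add] at h
      simp [h, h4] at hw

lemma reflEquiv_smul {V : Type*} [AddCommGroup V] [Module F V] {Q : QuadraticForm F V} {v : V}
    (hv : Q v ≠ 0) {s : F} (hsv : Q (s • v) ≠ 0) : reflEquiv Q (s • v) hsv = reflEquiv Q v hv := by
  have hs : s ≠ 0 := by
    rintro rfl
    simp at hsv
  refine LinearEquiv.ext fun y => ?_
  rw [reflEquiv_apply, reflEquiv_apply, QuadraticMap.map_smul, polar_smul_left, smul_smul]
  congr 2
  simp only [smul_eq_mul]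
  field_simp

/-- The number of vectors at which an anisotropic binary form takes a given nonzero value. -/
lemma card_level [Finite F] (hN : N.Anisotropic) {v : Fin 2 → F} (hv : v ≠ 0) :
    Nat.card {w // N w = N v} = Nat.card F + 1 := by
  have hr : ∀ o : Option F, N (lineRep o) ≠ 0 := fun o h => lineRep_ne_zero o (hN _ h)
  -- The `q + 1` lines of the plane index the reflections. A vector `w ≠ v` of the same value is hit
  -- by the line of `w - v` alone, and `v` by the line orthogonal to it.
  let Φ : Option F → {w // N w = N v} := fun o =>
    ⟨reflEquiv N (lineRep o) (hr o) v, reflEquiv_mem_isom (hr o) v⟩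
  have hΦ : Function.Bijective Φ := by
    constructor
    · intro o o' h
      have h1 : reflEquiv N (lineRep o) (hr o) v = reflEquiv N (lineRep o') (hr o') v :=
        congrArg Subtype.val h
      rw [reflEquiv_apply, reflEquiv_apply] at h1
      have h2 := sub_right_injective h1
      by_cases hs : (N (lineRep o))⁻¹ * polar N (lineRep o) v = 0
      · have hs' : (N (lineRep o'))⁻¹ * polar N (lineRep o') v = 0 := by
          rw [hs, zero_smul] at h2
          exact (smul_eq_zero.mp h2.symm).resolve_right (lineRep_ne_zero o')
        refine eq_of_polar_lineRep_eq_zero hN hv (v := v) ?_ ?_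
        · rw [polar_comm]
          exact (mul_eq_zero.mp hs).resolve_left (inv_ne_zero (hr o))
        · rw [polar_comm]
          exact (mul_eq_zero.mp hs').resolve_left (inv_ne_zero (hr o'))
      · exact eq_of_smul_lineRep_eq h2 hs
    · rintro ⟨w, hw⟩
      by_cases hwv : w = v
      · subst hwv
        obtain ⟨o, ho⟩ : ∃ o : Option F, polar N w (lineRep o) = 0 := by
          by_cases h0 : polar N w ![1, 0] = 0
          · exact ⟨none, h0⟩
          · refine ⟨some (- polar N w ![0, 1] / polar N w ![1, 0]), ?_⟩
            have hx : ∀ t : F, lineRep (some t) = t • ![1, 0] + ![0, 1] := by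
              intro t; funext i; fin_cases i <;> simp [lineRep]
            rw [hx, polar_add_right, polar_smul_right, smul_eq_mul]
            field_simp
            ring
        refine ⟨o, Subtype.ext ?_⟩
        change reflEquiv N (lineRep o) (hr o) w = w
        rw [reflEquiv_apply, polar_comm, ho, mul_zero, zero_smul, sub_zero]
      · obtain ⟨o, s, hos⟩ := exists_smul_lineRep (w - v)
        have hne : N (w - v) ≠ 0 := fun h => hwv (sub_eq_zero.mp (hN _ h))
        refine ⟨o, Subtype.ext ?_⟩
        change reflEquiv N (lineRep o) (hr o) v = w
        have h1 := reflEquiv_sub_apply hw.symm hne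
        rw [hos] at hne
        simp only [hos] at h1
        rwa [reflEquiv_smul (hr o)] at h1
  rw [← Nat.card_congr (Equiv.ofBijective Φ hΦ), Finite.card_option]

/-- The `l`-part of the order of the isometry group of an anisotropic binary form. -/
theorem factorization_card_isom_binary [Finite F] (hN : N.Anisotropic) {l : ℕ} (hl : l.Prime)
    (hl2 : l ≠ 2) :
    (Nat.card (isom N)).factorization l = (Nat.card F + 1).factorization l := by
  let v : Fin 2 → F := ![1, 0]
  have hv : v ≠ 0 := fun h => one_ne_zero (congrFun h 0)
  have horb : MulAction.orbit (isom N) v = {w | N w = N v} := by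
    ext w
    constructor
    · rintro ⟨g, rfl⟩
      exact g.2 v
    · intro hw
      by_cases hwv : w = v
      · rw [hwv]; exact MulAction.mem_orbit_self v
      · have hne : N (w - v) ≠ 0 := fun h => hwv (sub_eq_zero.mp (hN _ h))
        exact ⟨⟨_, reflEquiv_mem_isom hne⟩, reflEquiv_sub_apply (Eq.symm hw) hne⟩
  have hindex : (MulAction.stabilizer (isom N) v).index = Nat.card F + 1 := by
    rw [MulAction.index_stabilizer, horb, ← Nat.card_coe_set_eq]
    exact card_level hN hv
  -- An isometry fixing `v` is the identity or the reflection moving the second basis vector to its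
  -- image, so the stabilizer has exponent two.
  have hstab : ¬ l ∣ Nat.card (MulAction.stabilizer (isom N) v) := by
    refine not_dvd_card_of_mul_self hl hl2 ?_
    rintro ⟨⟨g, hg⟩, hgv⟩
    have hgv : g v = v := hgv
    refine Subtype.ext (Subtype.ext ?_)
    change g * g = 1
    have hext : ∀ h : (Fin 2 → F) ≃ₗ[F] (Fin 2 → F), h v = g v → h ![0, 1] = g ![0, 1] →
        h = g := by
      intro h h0 h1
      refine LinearEquiv.ext fun x => ?_
      have hx : x = x 0 • v + x 1 • ![0, 1] := by
        funext i; fin_cases i <;> simp [v]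
      rw [hx, map_add, map_add, map_smul, map_smul, map_smul, map_smul, h0, h1]
    by_cases h1 : g ![0, 1] = ![0, 1]
    · rw [← hext 1 hgv.symm h1.symm, one_mul]
    · have hne : N (g ![0, 1] - ![0, 1]) ≠ 0 := fun h => h1 (sub_eq_zero.mp (hN _ h))
      rw [← hext (reflEquiv N _ hne) ?_ (reflEquiv_sub_apply (hg _).symm hne)]
      · exact reflEquiv_mul_self hne
      · rw [reflEquiv_apply, polar_sub_left, hgv]
        nth_rewrite 2 [← hgv]
        rw [polar_of_mem_isom hg, sub_self, mul_zero, zero_smul, sub_zero]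
  rw [← Subgroup.card_mul_index (MulAction.stabilizer (isom N) v), hindex,
    Nat.factorization_mul Nat.card_pos.ne' (Nat.succ_ne_zero _), Finsupp.add_apply,
    Nat.factorization_eq_zero_of_not_dvd hstab, zero_add]

end Anisotropic

/-! ### The `l`-parts of the orders. -/

section Orders

variable {F : Type*} [Field F]

lemma anisotropic_smul_proj {c : F} (hc : c ≠ 0) :
    (c • QuadraticMap.proj (R := F) (A := F) (n := Fin 1) 0 0).Anisotropic := by
  intro x hx
  have : x 0 = 0 := by simpa [hc] using hx
  funext i
  rw [Subsingleton.elim i 0, this]; rfl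

variable [Finite F]

lemma card_zeros_odd {N : QuadraticForm F (Fin 1 → F)} (hN : N.Anisotropic) (m : ℕ) :
    Nat.card {x // addPlusForm N m x = 0} = Nat.card F ^ (2 * m) := by
  induction m with
  | zero => rw [card_zeros_addPlusForm_zero hN]; simp
  | succ m ih =>
    rw [card_zeros_addPlusForm_succ, ih]
    obtain ⟨t, ht⟩ := Nat.exists_eq_succ_of_ne_zero (Nat.card_pos (α := F)).ne'
    rw [ht, Nat.succ_sub_one]
    simp only [Nat.succ_eq_add_one]
    ring

lemma card_zeros_plus {N : QuadraticForm F (Fin 0 → F)} (hN : N.Anisotropic) (m : ℕ) :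
    Nat.card {x // addPlusForm N (m + 1) x = 0} + Nat.card F ^ m =
      Nat.card F ^ (2 * m + 1) + Nat.card F ^ (m + 1) := by
  obtain ⟨t, ht⟩ := Nat.exists_eq_succ_of_ne_zero (Nat.card_pos (α := F)).ne'
  induction m with
  | zero =>
    rw [card_zeros_addPlusForm_succ, card_zeros_addPlusForm_zero hN, ht, Nat.succ_sub_one]
    simp only [Nat.succ_eq_add_one]
    ring
  | succ m ih =>
    rw [card_zeros_addPlusForm_succ]
    rw [ht, Nat.succ_sub_one] at *
    simp only [Nat.succ_eq_add_one] at *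
    have := congrArg ((t + 1) * ·) ih
    simp only [mul_add] at this
    ring_nf at this ⊢
    linarith

lemma card_zeros_minus {N : QuadraticForm F (Fin 2 → F)} (hN : N.Anisotropic) (m : ℕ) :
    Nat.card {x // addPlusForm N m x = 0} + Nat.card F ^ (m + 1) =
      Nat.card F ^ (2 * m + 1) + Nat.card F ^ m := by
  obtain ⟨t, ht⟩ := Nat.exists_eq_succ_of_ne_zero (Nat.card_pos (α := F)).ne'
  induction m with
  | zero =>
    rw [card_zeros_addPlusForm_zero hN]
    ring
  | succ m ih =>
    rw [card_zeros_addPlusForm_succ]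
    rw [ht, Nat.succ_sub_one] at *
    simp only [Nat.succ_eq_add_one] at *
    have := congrArg ((t + 1) * ·) ih
    simp only [mul_add] at this
    ring_nf at this ⊢
    linarith

variable {l : ℕ} (hl : l.Prime) (hq : ¬ l ∣ Nat.card F)
include hl hq

omit [Field F] [Finite F] in
lemma factorization_pow_card (n : ℕ) : (Nat.card F ^ n).factorization l = 0 :=
  Nat.factorization_eq_zero_of_not_dvd fun h => hq (hl.dvd_of_dvd_pow h)

/-- Powers of `q` are prime to `l`, so only the number of nonzero singular vectors contributes. -/
lemma factorization_isom_succ {a : ℕ} {N : QuadraticForm F (Fin a → F)} (hN : N.Anisotropic)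
    (m : ℕ) : (Nat.card (isom (addPlusForm N (m + 1)))).factorization l =
      (Nat.card {x // addPlusForm N (m + 1) x = 0} - 1).factorization l +
        (Nat.card (isom (addPlusForm N m))).factorization l := by
  have h1 := (Nat.card_pos (α := isom (addPlusForm N (m + 1)))).ne'
  rw [card_isom_addPlusForm_succ hN] at h1 ⊢
  have h2 := left_ne_zero_of_mul h1
  rw [Nat.factorization_mul h2 (right_ne_zero_of_mul h1), Finsupp.add_apply,
    Nat.factorization_mul (left_ne_zero_of_mul h2) (right_ne_zero_of_mul h2), Finsupp.add_apply,
    factorization_pow_card hl hq, add_zero]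

lemma factorization_isom_odd (hl2 : l ≠ 2) {c : F} (hc : c ≠ 0) (m : ℕ) :
    (Nat.card (isom (oddForm c m))).factorization l =
      ∑ j ∈ Finset.range m, (Nat.card F ^ (2 * (j + 1)) - 1).factorization l := by
  have hN := anisotropic_smul_proj hc
  induction m with
  | zero =>
    rw [Finset.sum_range_zero]
    refine Nat.factorization_eq_zero_of_not_dvd ?_
    rw [oddForm, Nat.card_congr (isomCongr (addPlusFormZero _)).toEquiv]
    exact not_dvd_card_of_mul_self hl hl2 (isom_unary_mul_self hc)
  | succ m ih =>
    rw [Finset.sum_range_succ, ← ih, oddForm, factorization_isom_succ hl hq hN,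
      card_zeros_odd hN, add_comm]
    rfl

/-- The split form with `m + 1` planes has `(q ^ (m + 1) - 1) * (q ^ m + 1)` nonzero singular
vectors. The term `j = 0` involves `q ^ 0 + 1 = 2`, which has no `l`-part when `l` is odd. -/
lemma factorization_isom_plus (m : ℕ) :
    (Nat.card (isom (plusForm F m))).factorization l =
      ∑ j ∈ Finset.range m, ((Nat.card F ^ (j + 1) - 1).factorization l +
        (Nat.card F ^ j + 1).factorization l) := by
  have hN : (0 : QuadraticForm F (Fin 0 → F)).Anisotropic := fun x _ => Subsingleton.elim _ _
  rw [Nat.card_congr (isomCongr (plusFormEquiv m)).toEquiv]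
  induction m with
  | zero =>
    rw [Finset.sum_range_zero, Nat.card_congr (isomCongr (addPlusFormZero _)).toEquiv]
    have : Subsingleton (isom (0 : QuadraticForm F (Fin 0 → F))) :=
      ⟨fun g h => Subtype.ext (LinearEquiv.ext fun x => Subsingleton.elim _ _)⟩
    rw [Nat.card_of_subsingleton 1]
    simp
  | succ m ih =>
    rw [Finset.sum_range_succ, ← ih, factorization_isom_succ hl hq hN, add_comm]
    congr 1
    have hq1 : 1 < Nat.card F := Finite.one_lt_card
    have h : Nat.card {x // addPlusForm (0 : QuadraticForm F (Fin 0 → F)) (m + 1) x = 0} - 1 =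
        (Nat.card F ^ (m + 1) - 1) * (Nat.card F ^ m + 1) := by
      have h1 := card_zeros_plus hN m
      obtain ⟨s, hs⟩ := Nat.exists_eq_add_of_le' (Nat.one_le_pow (m + 1) (Nat.card F) (by omega))
      rw [hs] at h1 ⊢
      rw [Nat.add_sub_cancel]
      have h2 : Nat.card F ^ (2 * m + 1) = (s + 1) * Nat.card F ^ m := by rw [← hs]; ring
      rw [h2] at h1
      have : (s + 1) * Nat.card F ^ m = s * Nat.card F ^ m + Nat.card F ^ m := by ring
      rw [mul_add, mul_one]
      omega
    rw [h, Nat.factorization_mul _ (Nat.succ_ne_zero _), Finsupp.add_apply]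
    have : 1 < Nat.card F ^ (m + 1) := Nat.one_lt_pow (Nat.succ_ne_zero m) hq1
    omega

/-- The dimension is `2m + 2`. The summand `q + 1` comes from the binary form, and the step to `m +
1` planes from the count `(q ^ (m + 1) - 1) * (q ^ (m + 2) + 1)` of nonzero singular vectors. -/
lemma factorization_isom_minus (hl2 : l ≠ 2) {N : QuadraticForm F (Fin 2 → F)}
    (hN : N.Anisotropic) (m : ℕ) :
    (Nat.card (isom (addPlusForm N m))).factorization l = (Nat.card F + 1).factorization l +
      ∑ j ∈ Finset.range m, ((Nat.card F ^ (j + 1) - 1).factorization l +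
        (Nat.card F ^ (j + 2) + 1).factorization l) := by
  induction m with
  | zero =>
    rw [Finset.sum_range_zero, Nat.card_congr (isomCongr (addPlusFormZero _)).toEquiv,
      factorization_card_isom_binary hN hl hl2, add_zero]
  | succ m ih =>
    rw [Finset.sum_range_succ, ← add_assoc, ← ih, factorization_isom_succ hl hq hN, add_comm]
    congr 1
    have hq1 : 1 < Nat.card F := Finite.one_lt_card
    have h : Nat.card {x // addPlusForm N (m + 1) x = 0} - 1 =
        (Nat.card F ^ (m + 1) - 1) * (Nat.card F ^ (m + 2) + 1) := by
      have h1 := card_zeros_minus hN (m + 1)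
      obtain ⟨s, hs⟩ := Nat.exists_eq_add_of_le' (Nat.one_le_pow (m + 1) (Nat.card F) (by omega))
      have h2 : Nat.card F ^ (2 * (m + 1) + 1) = (s + 1) * Nat.card F ^ (m + 2) := by
        rw [← hs]; ring
      rw [h2, hs, show m + 1 + 1 = m + 2 from rfl] at h1
      rw [hs, Nat.add_sub_cancel]
      have : (s + 1) * Nat.card F ^ (m + 2) = s * Nat.card F ^ (m + 2) + Nat.card F ^ (m + 2) := by
        ring
      rw [mul_add, mul_one]
      omega
    rw [h, Nat.factorization_mul _ (Nat.succ_ne_zero _), Finsupp.add_apply]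
    have : 1 < Nat.card F ^ (m + 1) := Nat.one_lt_pow (Nat.succ_ne_zero m) hq1
    omega

lemma factorization_GL (n : ℕ) : (Nat.card (GL (Fin n) F)).factorization l =
    ∑ j ∈ Finset.range n, (Nat.card F ^ (j + 1) - 1).factorization l := by
  have := Fintype.ofFinite F
  have hq1 : 1 < Nat.card F := Finite.one_lt_card
  have hpos : ∀ j, Nat.card F ^ (j + 1) - 1 ≠ 0 := fun j => by
    have : 1 < Nat.card F ^ (j + 1) := Nat.one_lt_pow (Nat.succ_ne_zero j) hq1
    omega
  have hfac : ∀ i : Fin n, Nat.card F ^ n - Nat.card F ^ (i : ℕ) =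
      Nat.card F ^ (i : ℕ) * (Nat.card F ^ (n - 1 - i + 1) - 1) := fun i => by
    rw [Nat.mul_sub, mul_one, ← pow_add]
    congr 2
    omega
  rw [Matrix.card_GL_field, ← Nat.card_eq_fintype_card]
  simp_rw [hfac]
  rw [Nat.factorization_prod fun i _ => mul_ne_zero (pow_ne_zero _ (by omega)) (hpos _),
    Finsupp.finsetSum_apply]
  rw [← Finset.sum_range_reflect, Finset.sum_range]
  refine Finset.sum_congr rfl fun i _ => ?_
  rw [Nat.factorization_mul (pow_ne_zero _ (by omega)) (hpos _), Finsupp.add_apply,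
    factorization_pow_card hl hq, zero_add]

end Orders

/-! ### A criterion for the index of a commutator subgroup. -/

section Commutator

variable {G : Type*} [Group G]

/-- The elements of `S` having a power of exponent prime to `l` in the commutator subgroup. -/
def coprimePart (S : Subgroup G) [S.Normal] (l : ℕ) : Subgroup G where
  carrier := {g | g ∈ S ∧ ∃ M : ℕ, M.Coprime l ∧ g ^ M ∈ ⁅S, S⁆}
  one_mem' := ⟨one_mem S, 1, Nat.coprime_one_left l, by simp⟩
  inv_mem' := by
    rintro g ⟨hg, M, hM, h⟩
    exact ⟨inv_mem hg, M, hM, by rw [inv_pow]; exact inv_mem h⟩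
  mul_mem' := by
    rintro g h ⟨hg, M, hM, hgM⟩ ⟨hh, M', hM', hhM⟩
    refine ⟨mul_mem hg hh, M * M', Nat.Coprime.mul_left hM hM', ?_⟩
    have hcomm : Commute (QuotientGroup.mk' ⁅S, S⁆ g) (QuotientGroup.mk' ⁅S, S⁆ h) := by
      rw [← commutatorElement_eq_one_iff_commute, ← map_commutatorElement, QuotientGroup.mk'_apply,
        QuotientGroup.eq_one_iff]
      exact Subgroup.commutator_mem_commutator hg hh
    rw [← QuotientGroup.eq_one_iff, ← QuotientGroup.mk'_apply] at hgM hhM ⊢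
    rw [map_pow] at hgM hhM
    rw [map_pow, map_mul, hcomm.mul_pow, pow_mul, hgM, one_pow, mul_comm M, pow_mul, hhM, one_pow,
      one_mul]

instance (S : Subgroup G) [S.Normal] (l : ℕ) : (coprimePart S l).Normal where
  conj_mem := by
    rintro g ⟨hg, M, hM, h⟩ x
    refine ⟨Subgroup.Normal.conj_mem inferInstance g hg x, M, hM, ?_⟩
    rw [conj_pow]
    exact Subgroup.Normal.conj_mem inferInstance _ h x

lemma mem_coprimePart_of_pow_eq_one {S : Subgroup G} [S.Normal] {l M : ℕ} {g : G} (hg : g ∈ S)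
    (hM : M.Coprime l) (h : g ^ M = 1) : g ∈ coprimePart S l :=
  ⟨hg, M, hM, by rw [h]; exact one_mem _⟩

/-- A criterion for the commutator subgroup of a normal subgroup to have index prime to `l`. -/
theorem not_dvd_index_commutator [Finite G] (S : Subgroup G) [S.Normal] {l : ℕ} (hl : l.Prime)
    (hl2 : l ≠ 2) {R : Set G} (hR : Subgroup.closure R = ⊤) (r₀ : G)
    (h₀ : r₀ * r₀ ∈ coprimePart S l)
    (h : ∀ r ∈ R, r ∈ coprimePart S l ∨ r * r₀⁻¹ ∈ coprimePart S l) : ¬ l ∣ ⁅S, S⁆.index := by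
  have : Fact l.Prime := ⟨hl⟩
  let π := QuotientGroup.mk' (coprimePart S l)
  have hπ : ∀ g, π g = 1 ↔ g ∈ coprimePart S l := fun g => QuotientGroup.eq_one_iff g
  -- Modulo `coprimePart S l` the group is generated by `r₀`, whose square is trivial there.
  have htop : Subgroup.closure R ≤ (Subgroup.zpowers (π r₀)).comap π := by
    rw [Subgroup.closure_le]
    intro r hr
    rw [SetLike.mem_coe, Subgroup.mem_comap]
    rcases h r hr with h | h
    · rw [(hπ r).mpr h]; exact one_mem _
    · have := (hπ _).mpr h
      rw [map_mul, map_inv, mul_inv_eq_one] at this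
      rw [this]
      exact Subgroup.mem_zpowers _
  have hsq : ∀ g : G, g * g ∈ coprimePart S l := by
    intro g
    obtain ⟨n, hn⟩ := htop (hR.ge (Subgroup.mem_top g))
    have hn : π r₀ ^ n = π g := hn
    rw [← hπ, map_mul, ← hn, ← (Commute.refl (π r₀)).mul_zpow, ← map_mul, (hπ _).mpr h₀, one_zpow]
  -- An element of order `l` modulo `⁅S, S⁆` would have order dividing `2 * M` with `M` prime to
  -- `l`.
  intro hdvd
  rw [Subgroup.index_eq_card] at hdvd
  obtain ⟨x, hx⟩ := exists_prime_orderOf_dvd_card' l hdvd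
  obtain ⟨g, rfl⟩ := QuotientGroup.mk_surjective x
  obtain ⟨-, M, hM, hgM⟩ := hsq g
  rw [← pow_two, ← pow_mul, ← QuotientGroup.eq_one_iff, QuotientGroup.mk_pow] at hgM
  have hdvd := orderOf_dvd_of_pow_eq_one hgM
  rw [hx, hl.dvd_mul] at hdvd
  rcases hdvd with hdvd | hdvd
  · exact hl2 ((Nat.prime_dvd_prime_iff_eq hl Nat.prime_two).mp hdvd)
  · exact hl.one_lt.ne' (Nat.dvd_one.mp (hM ▸ Nat.dvd_gcd hdvd dvd_rfl))

end Commutator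

/-! ### Determinants and commutation of reflections. -/

section Orthogonal

variable {F : Type*} [Field F] {V : Type*} [AddCommGroup V] [Module F V]
  {Q : QuadraticForm F V}

/-- A reflection is a transvection along `v` whose functional takes the value `-2` at `v`, so the
determinant is `1 - 2`. -/
lemma det_reflEquiv [Module.Finite F V] {v : V} (hv : Q v ≠ 0) :
    LinearMap.det (reflEquiv Q v hv : V →ₗ[F] V) = -1 := by
  have : (reflEquiv Q v hv : V →ₗ[F] V) =
      LinearMap.transvection (-((Q v)⁻¹ • Q.polarBilin v)) v := by
    refine LinearMap.ext fun y => ?_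
    rw [LinearEquiv.coe_coe, reflEquiv_apply, LinearMap.transvection.apply]
    simp [sub_eq_add_neg]
  rw [this, LinearMap.transvection.det]
  simp only [LinearMap.neg_apply, LinearMap.smul_apply, polarBilin_apply_apply, polar_self,
    smul_eq_mul, nsmul_eq_mul]
  field_simp
  norm_num

/-- In dimension at least four two nonsingular vectors are orthogonal to a third one. -/
lemma exists_orthogonal_nonsingular [Module.Finite F V] (hQ : Regular Q) (h2 : (2 : F) ≠ 0)
    (hdim : 4 ≤ Module.finrank F V) {u v : V} (hu : Q u ≠ 0) :
    ∃ w, Q w ≠ 0 ∧ polar Q u w = 0 ∧ polar Q v w = 0 := by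
  -- Otherwise the complement `W` of the span `U` of `u` and `v` is totally singular, hence
  -- contained in its own complement `U`. Dimensions force `W = U`, and `u` would be singular.
  by_contra! hno
  let B : LinearMap.BilinForm F V := Q.polarBilin
  have hrefl : B.IsRefl := fun x y h => by
    rw [← h]; exact polar_comm Q y x
  have hnd : B.Nondegenerate := by
    refine (LinearMap.IsRefl.nondegenerate_iff_separatingLeft hrefl).mpr fun x hx => hQ x hx ?_
    have : polar Q x x = 0 := hx x
    rw [polar_self, nsmul_eq_mul] at this
    exact (mul_eq_zero.mp this).resolve_left (by exact_mod_cast h2)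
  let U : Submodule F V := Submodule.span F {u, v}
  let W := B.orthogonal U
  have hW : ∀ w ∈ W, Q w = 0 := by
    intro w hw
    by_contra h
    rw [LinearMap.BilinForm.mem_orthogonal_iff] at hw
    exact hno w h (hw u (Submodule.subset_span (by simp))) (hw v (Submodule.subset_span (by simp)))
  have hWW : W ≤ U := by
    rw [← LinearMap.BilinForm.orthogonal_orthogonal hnd hrefl U]
    intro w hw
    rw [LinearMap.BilinForm.mem_orthogonal_iff]
    intro w' hw'
    change polar Q w' w = 0
    rw [polar, hW _ (add_mem hw' hw), hW _ hw, hW _ hw']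
    simp
  have hU : Module.finrank F U ≤ 2 := by
    classical
    refine (finrank_span_le_card _).trans ?_
    rw [Set.toFinset_insert, Set.toFinset_singleton]
    exact Finset.card_le_two
  have hfW := LinearMap.BilinForm.finrank_orthogonal hnd U
  have heq : W = U := Submodule.eq_of_le_of_finrank_le hWW (by
    change _ ≤ Module.finrank F (B.orthogonal U)
    omega)
  exact hu (hW u (heq ▸ Submodule.subset_span (by simp)))

lemma reflEquiv_commute {u w : V} (hu : Q u ≠ 0) (hw : Q w ≠ 0) (h : polar Q u w = 0) :
    reflEquiv Q u hu * reflEquiv Q w hw = reflEquiv Q w hw * reflEquiv Q u hu := by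
  refine LinearEquiv.ext fun y => ?_
  simp only [LinearEquiv.mul_apply, reflEquiv_apply, polar_sub_right, polar_smul_right, h,
    polar_comm Q w u, smul_zero, sub_zero]
  abel

end Orthogonal

/-! ### The index of `Ω` in the orthogonal group. -/

section Matrices

variable {F : Type v} [Field F] {ι : Type} [Fintype ι] [DecidableEq ι]

/-- Invertible matrices as linear automorphisms. -/
def glEquiv : GL ι F ≃* ((ι → F) ≃ₗ[F] (ι → F)) :=
  Matrix.GeneralLinearGroup.toLin.trans (LinearMap.GeneralLinearGroup.generalLinearEquiv F (ι → F))

lemma det_glEquiv (M : GL ι F) :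
    LinearMap.det (glEquiv M : (ι → F) →ₗ[F] (ι → F)) = (M : Matrix ι ι F).det :=
  LinearMap.det_toLin' _

variable {Q : QuadraticForm F (ι → F)}

lemma glEquiv_mem_isom {M : GL ι F} : glEquiv M ∈ isom Q ↔ M ∈ O Q := Iff.rfl

/-- The orthogonal group of matrices is the isometry group. -/
def oEquiv (Q : QuadraticForm F (ι → F)) : O Q ≃* isom Q :=
  (glEquiv.subgroupMap (O Q)).trans (MulEquiv.subgroupCongr (by
    ext g
    obtain ⟨M, rfl⟩ := glEquiv.surjective g
    rw [glEquiv_mem_isom]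
    exact ⟨fun ⟨M', h, h'⟩ => glEquiv.injective h' ▸ h, fun h => ⟨M, h, rfl⟩⟩))

lemma coe_oEquiv (M : O Q) : (oEquiv Q M : (ι → F) ≃ₗ[F] (ι → F)) = glEquiv M.1 := rfl

instance : ((SO Q).subgroupOf (O Q)).Normal where
  conj_mem := fun M hM A => by
    rw [Subgroup.mem_subgroupOf] at hM ⊢
    refine ⟨(A * M * A⁻¹).2, ?_⟩
    have := MonoidHom.mem_ker.mp hM.2
    refine MonoidHom.mem_ker.mpr ?_
    simp only [Subgroup.coe_mul, map_mul, this, mul_one, Subgroup.coe_inv, map_inv, mul_inv_cancel]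

lemma mem_SO_subgroupOf {M : O Q} :
    M ∈ (SO Q).subgroupOf (O Q) ↔ LinearMap.det (oEquiv Q M : (ι → F) →ₗ[F] (ι → F)) = 1 := by
  rw [coe_oEquiv, det_glEquiv, Subgroup.mem_subgroupOf, SO, Subgroup.mem_inf, MonoidHom.mem_ker,
    Units.ext_iff]
  exact and_iff_right M.2

/-- Elements of order `p` and involutions of determinant one lie in `coprimePart`. It remains to see
that all reflections agree modulo such elements. -/
theorem not_dvd_index_commutator_SO [Finite F] {p l : ℕ} (hp : p.Prime) [CharP F p] (hl : l.Prime)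
    (hl2 : l ≠ 2) (hlp : l ≠ p) (hQ : Regular Q) (hgen : GeneratedBy p Q)
    (hn : p = 2 ∨ Odd (Fintype.card ι) ∨ 4 ≤ Fintype.card ι ∨ Fintype.card ι = 0) :
    ¬ l ∣ ⁅(SO Q).subgroupOf (O Q), (SO Q).subgroupOf (O Q)⁆.index := by
  set S := (SO Q).subgroupOf (O Q) with hS
  let R : Set (O Q) :=
    {M | (oEquiv Q M).1 ∈ reflections Q ∪ {g | g ∈ isom Q ∧ g ^ p = 1}}
  have hR : Subgroup.closure R = ⊤ := by
    let ψ : O Q →* ((ι → F) ≃ₗ[F] (ι → F)) := (isom Q).subtype.comp (oEquiv Q).toMonoidHom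
    have hψ : Function.Injective ψ := Subtype.val_injective.comp (oEquiv Q).injective
    have hle : Subgroup.closure (reflections Q ∪ {g | g ∈ isom Q ∧ g ^ p = 1}) ≤
        (Subgroup.closure R).map ψ := by
      rw [Subgroup.closure_le]
      intro g hg
      have hgi : g ∈ isom Q := by
        rcases hg with ⟨v, hv, rfl⟩ | hg
        · exact reflEquiv_mem_isom hv
        · exact hg.1
      obtain ⟨M, hM⟩ := (oEquiv Q).surjective ⟨g, hgi⟩
      refine ⟨M, Subgroup.subset_closure ?_, congrArg Subtype.val hM⟩
      change (oEquiv Q M).1 ∈ reflections Q ∪ {g | g ∈ isom Q ∧ g ^ p = 1}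
      rwa [hM]
    rw [eq_top_iff]
    intro M _
    obtain ⟨M', hM', h⟩ := hle (hgen (oEquiv Q M).2)
    exact hψ h ▸ hM'
  have hpl : p.Coprime l := (Nat.coprime_primes hp hl).mpr (Ne.symm hlp)
  have h2l : Nat.Coprime 2 l := (Nat.coprime_primes Nat.prime_two hl).mpr (Ne.symm hl2)
  have hpow : ∀ M : O Q, M ^ p = 1 → M ∈ coprimePart S l := by
    intro M hM
    refine mem_coprimePart_of_pow_eq_one ?_ hpl hM
    rw [hS, mem_SO_subgroupOf, coe_oEquiv, det_glEquiv]
    have h1 : (M.1 : Matrix ι ι F).det ^ p = 1 := by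
      have : ((M ^ p : O Q) : GL ι F) = 1 := by rw [hM]; rfl
      rw [← Matrix.det_pow, ← Units.val_pow_eq_pow_val, ← Subgroup.coe_pow, this]
      simp
    have := Fact.mk hp
    -- A determinant whose `p`-th power is `1` is `1`, since Frobenius is injective.
    exact frobenius_inj F p (by simpa [frobenius_def] using h1)
  have hord : ∀ M : O Q, M ∈ R → M ∈ coprimePart S l ∨ (oEquiv Q M).1 ∈ reflections Q := by
    rintro M (hM | hM)
    · exact Or.inr hM
    · refine Or.inl (hpow M ((oEquiv Q).injective (Subtype.ext ?_)))
      rw [map_pow, map_one]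
      exact hM.2
  have hsq : ∀ M : O Q, (oEquiv Q M).1 ∈ reflections Q → M * M = 1 := by
    rintro M ⟨v, hv, h⟩
    refine (oEquiv Q).injective (Subtype.ext ?_)
    rw [map_mul, Subgroup.coe_mul, h, reflEquiv_mul_self, map_one]
    rfl
  have hdet : ∀ M : O Q, (oEquiv Q M).1 ∈ reflections Q → (M.1 : Matrix ι ι F).det = -1 := by
    rintro M ⟨v, hv, h⟩
    rw [← det_glEquiv, ← coe_oEquiv, h, det_reflEquiv]
  have hinv2 : ∀ M : O Q, (M.1 : Matrix ι ι F).det = 1 → M * M = 1 → M ∈ coprimePart S l := by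
    intro M hM hM2
    refine mem_coprimePart_of_pow_eq_one ?_ h2l (by rw [pow_two, hM2])
    rw [hS, mem_SO_subgroupOf, coe_oEquiv, det_glEquiv, hM]
  rcases eq_or_ne p 2 with hp2 | hp2
  -- In characteristic two reflections themselves have order `p`.
  · refine not_dvd_index_commutator S hl hl2 hR 1 (by simp) fun M hM => Or.inl ?_
    rcases hord M hM with h | h
    · exact h
    · exact hpow M (by rw [hp2, pow_two, hsq M h])
  have h2 : (2 : F) ≠ 0 := fun h => by
    have : p ∣ 2 := (CharP.cast_eq_zero_iff F p 2).mp (by exact_mod_cast h)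
    exact hp2 ((Nat.prime_dvd_prime_iff_eq hp Nat.prime_two).mp this)
  rcases hn.resolve_left hp2 with hodd | h4 | h0
  -- In odd dimension `-1` is central of determinant `-1`, so the negative of a reflection is an
  -- involution of determinant one.
  · let r₀ : O Q := ⟨-1, fun x => by
      rw [Units.val_neg, Units.val_one, Matrix.neg_mulVec, Matrix.one_mulVec, QuadraticMap.map_neg]⟩
    have hr₀ : r₀ * r₀ = 1 := Subtype.ext (by simp [r₀])
    refine not_dvd_index_commutator S hl hl2 hR r₀ (by rw [hr₀]; exact one_mem _) fun M hM => ?_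
    refine (hord M hM).imp_right fun h => ?_
    have hinv : r₀⁻¹ = r₀ := inv_eq_of_mul_eq_one_left hr₀
    rw [hinv]
    refine hinv2 _ ?_ ?_
    · rw [Subgroup.coe_mul, Units.val_mul, Matrix.det_mul, hdet M h]
      simp [r₀, Matrix.det_neg, hodd.neg_one_pow]
    · have hc : r₀ * M = M * r₀ := Subtype.ext (by simp [r₀])
      rw [mul_assoc, ← mul_assoc r₀, hc, mul_assoc, hr₀, mul_one, hsq M h]
  -- For two reflections `M`, `r₀` take the reflection `A` in a vector orthogonal to both of theirs.
  -- Then `M * r₀ = (M * A) * (A * r₀)`, and both factors are products of commuting reflections, so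
  -- involutions of determinant one.
  · by_cases hex : ∃ M : O Q, (oEquiv Q M).1 ∈ reflections Q
    · obtain ⟨r₀, hr₀⟩ := hex
      refine not_dvd_index_commutator S hl hl2 hR r₀ (by rw [hsq _ hr₀]; exact one_mem _)
        fun M hM => ?_
      refine (hord M hM).imp_right fun h => ?_
      rw [inv_eq_of_mul_eq_one_left (hsq _ hr₀)]
      have horth : ∀ M M' : O Q, (oEquiv Q M).1 ∈ reflections Q → (oEquiv Q M').1 ∈ reflections Q →
          M * M' = M' * M → M * M' ∈ coprimePart S l := by
        intro M M' h h' hc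
        refine hinv2 _ ?_ ?_
        · rw [Subgroup.coe_mul, Units.val_mul, Matrix.det_mul, hdet M h, hdet M' h']
          ring
        · nth_rewrite 2 [hc]
          rw [mul_assoc, ← mul_assoc M', hsq M' h', one_mul, hsq M h]
      have hcomm : ∀ (M M' : O Q) (u w : ι → F) (hu : Q u ≠ 0) (hw : Q w ≠ 0),
          (oEquiv Q M).1 = reflEquiv Q u hu → (oEquiv Q M').1 = reflEquiv Q w hw →
          polar Q u w = 0 → M * M' = M' * M := by
        intro M M' u w hu hw hM hM' huw
        refine (oEquiv Q).injective (Subtype.ext ?_)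
        rw [map_mul, map_mul, Subgroup.coe_mul, Subgroup.coe_mul, hM, hM', reflEquiv_commute hu hw huw]
      obtain ⟨u, hu, hMu⟩ := id h
      obtain ⟨v, hv, hrv⟩ := id hr₀
      obtain ⟨w, hw, huw, hvw⟩ := exists_orthogonal_nonsingular hQ h2
        (by rwa [Module.finrank_fintype_fun_eq_card]) (v := v) hu
      obtain ⟨A, hA⟩ := (oEquiv Q).surjective ⟨_, reflEquiv_mem_isom hw⟩
      have hA' : (oEquiv Q A).1 = reflEquiv Q w hw := congrArg Subtype.val hA
      have hprod : M * r₀ = M * A * (A * r₀) := by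
        rw [mul_assoc, ← mul_assoc A, hsq A ⟨w, hw, hA'⟩, one_mul]
      rw [hprod]
      exact mul_mem (horth _ _ h ⟨w, hw, hA'⟩ (hcomm _ _ u w hu hw hMu hA' huw))
        (horth _ _ ⟨w, hw, hA'⟩ hr₀ (hcomm _ _ v w hv hw hrv hA' hvw).symm)
    · refine not_dvd_index_commutator S hl hl2 hR 1 (by simp) fun M hM => Or.inl ?_
      exact (hord M hM).resolve_right fun h => hex ⟨M, h⟩
  · have : IsEmpty ι := Fintype.card_eq_zero_iff.mp h0
    refine not_dvd_index_commutator S hl hl2 hR 1 (by simp) fun M hM => Or.inl ?_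
    rw [Subsingleton.elim M 1]
    exact one_mem _

/-- `Ω` has index prime to `l` in the orthogonal group. -/
theorem factorization_card_Omega [Finite F] {l : ℕ}
    (h : ¬ l ∣ ⁅(SO Q).subgroupOf (O Q), (SO Q).subgroupOf (O Q)⁆.index) :
    (Nat.card (Omega Q)).factorization l = (Nat.card (O Q)).factorization l := by
  have hmap : (⁅(SO Q).subgroupOf (O Q), (SO Q).subgroupOf (O Q)⁆).map (O Q).subtype = Omega Q := by
    rw [Subgroup.map_commutator, Subgroup.map_subgroupOf_eq_of_le (show SO Q ≤ O Q from inf_le_left), Omega]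
  rw [← hmap, Nat.card_congr (Subgroup.equivMapOfInjective _ _ (O Q).subtype_injective).toEquiv.symm,
    ← Subgroup.card_mul_index ⁅(SO Q).subgroupOf (O Q), (SO Q).subgroupOf (O Q)⁆,
    Nat.factorization_mul Nat.card_pos.ne' Subgroup.index_ne_zero_of_finite, Finsupp.add_apply,
    Nat.factorization_eq_zero_of_not_dvd h, add_zero]

open EssDim in
/-- The essential dimensions of `PΩ` and of the orthogonal group agree. -/
theorem essDimAt_POmega {k : Type u} [Field k] [Finite F] {l : ℕ} (hl : l.Prime) (hl2 : l ≠ 2)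
    (h : ¬ l ∣ ⁅(SO Q).subgroupOf (O Q), (SO Q).subgroupOf (O Q)⁆.index) :
    essDimAt k (POmega Q) l = essDimAt k (O Q) l := by
  have hsigns : ¬ l ∣ Nat.card ((signs F ι).subgroupOf (Omega Q)) := by
    refine not_dvd_card_of_mul_self hl hl2 ?_
    rintro ⟨⟨M, hM⟩, hs⟩
    refine Subtype.ext (Subtype.ext ?_)
    change M * M = 1
    rcases (hs : M = 1 ∨ M = -1) with rfl | rfl <;> simp
  have h1 : essDimAt k (Omega Q) l = essDimAt k (POmega Q) l := by
    refine essDimAt_eq_of_hom (QuotientGroup.mk' ((signs F ι).subgroupOf (Omega Q))) hl ?_ ?_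
    · rwa [QuotientGroup.ker_mk']
    · rw [Subgroup.card_eq_card_quotient_mul_card_subgroup ((signs F ι).subgroupOf (Omega Q)),
        Nat.factorization_mul Nat.card_pos.ne' Nat.card_pos.ne', Finsupp.add_apply,
        Nat.factorization_eq_zero_of_not_dvd hsigns, add_zero]
  have hle : Omega Q ≤ O Q := (Subgroup.commutator_le.mpr fun g hg h hh => by
    rw [commutatorElement_def]
    exact mul_mem (mul_mem (mul_mem hg hh) (inv_mem hg)) (inv_mem hh)).trans
      (show SO Q ≤ O Q from inf_le_left)
  rw [← h1]
  refine essDimAt_eq_of_hom (Subgroup.inclusion hle) hl ?_ (factorization_card_Omega h)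
  rw [(MonoidHom.ker_eq_bot_iff _).mpr (Subgroup.inclusion_injective hle), Subgroup.card_bot]
  exact hl.one_lt.ne' ∘ Nat.dvd_one.mp

end Matrices

open EssDim

/-! ### Embeddings among orthogonal and general linear groups. -/

section Embeddings

variable {F : Type v} [Field F]

/-- The block diagonal embedding `M ↦ diag(1, M)`. -/
def blockHom (κ : Type) [Fintype κ] [DecidableEq κ] {ι : Type} [Fintype ι] [DecidableEq ι] :
    GL ι F →* GL (κ ⊕ ι) F :=
  MonoidHom.toHomUnits
    { toFun := fun M => Matrix.fromBlocks 1 0 0 (M : Matrix ι ι F)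
      map_one' := by simp
      map_mul' := fun M N => by simp [Matrix.fromBlocks_multiply] }

lemma coe_blockHom (κ : Type) [Fintype κ] [DecidableEq κ] {ι : Type} [Fintype ι] [DecidableEq ι]
    (M : GL ι F) : (blockHom κ M : Matrix (κ ⊕ ι) (κ ⊕ ι) F) = Matrix.fromBlocks 1 0 0 M := rfl

lemma blockHom_injective (κ : Type) [Fintype κ] [DecidableEq κ] {ι : Type} [Fintype ι]
    [DecidableEq ι] : Function.Injective (blockHom (F := F) κ (ι := ι)) := fun M N h => by
  have := congrArg Units.val h
  rw [coe_blockHom, coe_blockHom, Matrix.fromBlocks_inj] at this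
  exact Units.ext this.2.2.2

/-- The embedding `M ↦ diag(M, M⁻ᵀ)` of the general linear group into the split orthogonal
group. -/
def hyperbolicHom (m : ℕ) : GL (Fin m) F →* O (plusForm F m) :=
  (MonoidHom.toHomUnits
    { toFun := fun M : GL (Fin m) F => Matrix.fromBlocks (M : Matrix (Fin m) (Fin m) F) 0 0
        ((M⁻¹ : GL (Fin m) F) : Matrix (Fin m) (Fin m) F).transpose
      map_one' := by simp
      map_mul' := fun M N => by
        rw [mul_inv_rev, Units.val_mul, Units.val_mul, Matrix.transpose_mul]
        simp [Matrix.fromBlocks_multiply] }).codRestrict _ fun M x => by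
    change plusForm F m ((Matrix.fromBlocks (M : Matrix (Fin m) (Fin m) F) 0 0
        ((M⁻¹ : GL (Fin m) F) : Matrix (Fin m) (Fin m) F).transpose).mulVec x) = _
    rw [Matrix.fromBlocks_mulVec, plusForm_apply, plusForm_apply]
    simp only [Sum.elim_inl, Sum.elim_inr, Matrix.zero_mulVec, add_zero, zero_add]
    change ((M : Matrix (Fin m) (Fin m) F).mulVec (x ∘ Sum.inl)) ⬝ᵥ
      (((M⁻¹ : GL (Fin m) F) : Matrix (Fin m) (Fin m) F).transpose.mulVec (x ∘ Sum.inr)) =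
      (x ∘ Sum.inl) ⬝ᵥ (x ∘ Sum.inr)
    rw [Matrix.mulVec_transpose, dotProduct_comm, ← Matrix.dotProduct_mulVec,
      Matrix.mulVec_mulVec, ← Units.val_mul, inv_mul_cancel, Units.val_one, Matrix.one_mulVec,
      dotProduct_comm]

lemma hyperbolicHom_injective (m : ℕ) : Function.Injective (hyperbolicHom (F := F) m) :=
  fun M N h => by
  have : Matrix.fromBlocks (M : Matrix (Fin m) (Fin m) F) 0 0 _ = Matrix.fromBlocks N.1 0 0 _ :=
    congrArg (fun A : O (plusForm F m) => (A.1 : Matrix (Fin m ⊕ Fin m) (Fin m ⊕ Fin m) F)) h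
  exact Units.ext (Matrix.fromBlocks_inj.mp this).1

/-- Extending isometries of the split form by the identity on the other summand. -/
def plusHom {a : ℕ} (N : QuadraticForm F (Fin a → F)) (m : ℕ) :
    O (plusForm F m) →* O (addPlusForm N m) :=
  ((blockHom (Fin a)).comp (O (plusForm F m)).subtype).codRestrict _ fun M x => by
    have hM : plusForm F m ((M.1 : Matrix (Fin m ⊕ Fin m) (Fin m ⊕ Fin m) F).mulVec (x ∘ Sum.inr)) =
      plusForm F m (x ∘ Sum.inr) := M.2 _
    change addPlusForm N m ((Matrix.fromBlocks 1 0 0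
      (M.1 : Matrix (Fin m ⊕ Fin m) (Fin m ⊕ Fin m) F)).mulVec x) = _
    rw [Matrix.fromBlocks_mulVec]
    simp only [Matrix.zero_mulVec, add_zero, zero_add, Matrix.one_mulVec]
    change N (x ∘ Sum.inl) + plusForm F m _ = N (x ∘ Sum.inl) + plusForm F m (x ∘ Sum.inr)
    rw [← hM]
    rfl

lemma plusHom_injective {a : ℕ} (N : QuadraticForm F (Fin a → F)) (m : ℕ) :
    Function.Injective (plusHom N m) := fun _ _ h =>
  Subtype.ext (blockHom_injective _ (congrArg Subtype.val h))

/-- Extending isometries by the identity on a hyperbolic plane. -/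
def succHom {a : ℕ} (N : QuadraticForm F (Fin a → F)) (m : ℕ) :
    isom (addPlusForm N m) →* isom (addPlusForm N (m + 1)) :=
  (isomCongr (addPlusFormSucc N m)).symm.toMonoidHom.comp
    ((extHyp.comp (isom (addPlusForm N m)).subtype).codRestrict _ fun g => extHyp_mem_isom g.2)

lemma succHom_injective {a : ℕ} (N : QuadraticForm F (Fin a → F)) (m : ℕ) :
    Function.Injective (succHom N m) := fun _ _ h =>
  Subtype.ext (extHyp_injective
    (congrArg Subtype.val ((isomCongr (addPlusFormSucc N m)).symm.injective h)))

lemma exists_injective_GL {ι : Type} [Fintype ι] [DecidableEq ι] {a b : ℕ}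
    (ha : Fintype.card ι = a) (hab : a ≤ b) :
    ∃ f : GL ι F →* GL (Fin b) F, Function.Injective f := by
  have e : Fin (b - a) ⊕ ι ≃ Fin b := Fintype.equivFinOfCardEq (by simp [ha, hab])
  let g : GL (Fin (b - a) ⊕ ι) F ≃* GL (Fin b) F :=
    Units.mapEquiv (Matrix.reindexAlgEquiv F F e).toMulEquiv
  exact ⟨g.toMonoidHom.comp (blockHom _), g.injective.comp (blockHom_injective _)⟩

end Embeddings

/-! ### Equal `l`-parts along these embeddings. -/

section Comparison

variable {k : Type u} [Field k] {l : ℕ}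

/-- An embedding of finite groups of the same `l`-part preserves the essential `l`-dimension. -/
theorem essDimAt_eq_of_embedding {G G' : Type v} [Group G] [Group G'] [Finite G] [Finite G']
    (hl : l.Prime) (h : (Nat.card G').factorization l = (Nat.card G).factorization l)
    {f : G' →* G} (hf : Function.Injective f) : essDimAt k G' l = essDimAt k G l := by
  refine essDimAt_eq_of_hom f hl ?_ h
  rw [(MonoidHom.ker_eq_bot_iff _).mpr hf, Subgroup.card_bot]
  exact hl.one_lt.ne' ∘ Nat.dvd_one.mp

variable {F : Type v} [Field F]

lemma card_O {ι : Type} [Fintype ι] [DecidableEq ι] (Q : QuadraticForm F (ι → F)) :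
    Nat.card (O Q) = Nat.card (isom Q) := Nat.card_congr (oEquiv Q).toEquiv

variable [Finite F]

lemma essDimAt_O_eq_GL {ι : Type} [Fintype ι] [DecidableEq ι] (Q : QuadraticForm F (ι → F))
    (hl : l.Prime) {b : ℕ} (hb : Fintype.card ι ≤ b)
    (h : (Nat.card (isom Q)).factorization l = (Nat.card (GL (Fin b) F)).factorization l) :
    essDimAt k (O Q) l = essDimAt k (GL (Fin b) F) l := by
  obtain ⟨f, hf⟩ := exists_injective_GL (F := F) (ι := ι) rfl hb
  exact essDimAt_eq_of_embedding hl (by rw [card_O, h])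
    (f := f.comp (O Q).subtype) (hf.comp (O Q).subtype_injective)

lemma essDimAt_GL_eq_GL (hl : l.Prime) {a b : ℕ} (hab : a ≤ b)
    (h : (Nat.card (GL (Fin a) F)).factorization l = (Nat.card (GL (Fin b) F)).factorization l) :
    essDimAt k (GL (Fin a) F) l = essDimAt k (GL (Fin b) F) l := by
  obtain ⟨f, hf⟩ := exists_injective_GL (F := F) (ι := Fin a) (Fintype.card_fin a) hab
  exact essDimAt_eq_of_embedding hl h hf

lemma essDimAt_GL_eq_plus (hl : l.Prime) {m : ℕ}
    (h : (Nat.card (GL (Fin m) F)).factorization l =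
      (Nat.card (isom (plusForm F m))).factorization l) :
    essDimAt k (GL (Fin m) F) l = essDimAt k (O (plusForm F m)) l :=
  essDimAt_eq_of_embedding hl (by rw [card_O, h]) (hyperbolicHom_injective m)

lemma essDimAt_plus_eq_addPlus {a : ℕ} (N : QuadraticForm F (Fin a → F)) (hl : l.Prime) {m : ℕ}
    (h : (Nat.card (isom (plusForm F m))).factorization l =
      (Nat.card (isom (addPlusForm N m))).factorization l) :
    essDimAt k (O (plusForm F m)) l = essDimAt k (O (addPlusForm N m)) l :=
  essDimAt_eq_of_embedding hl (by rw [card_O, card_O, h]) (plusHom_injective N m)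

lemma essDimAt_addPlus_succ {a : ℕ} (N : QuadraticForm F (Fin a → F)) (hl : l.Prime) {m : ℕ}
    (h : (Nat.card (isom (addPlusForm N m))).factorization l =
      (Nat.card (isom (addPlusForm N (m + 1)))).factorization l) :
    essDimAt k (O (addPlusForm N m)) l = essDimAt k (O (addPlusForm N (m + 1))) l := by
  rw [essDimAt_congr (oEquiv _) l, essDimAt_congr (oEquiv (addPlusForm N (m + 1))) l]
  exact essDimAt_eq_of_embedding hl h (succHom_injective N m)

lemma essDimAt_plus_succ (hl : l.Prime) {m : ℕ}
    (h : (Nat.card (isom (plusForm F m))).factorization l =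
      (Nat.card (isom (plusForm F (m + 1)))).factorization l) :
    essDimAt k (O (plusForm F m)) l = essDimAt k (O (plusForm F (m + 1))) l := by
  have h1 : ∀ n, essDimAt k (O (plusForm F n)) l =
      essDimAt k (O (addPlusForm (0 : QuadraticForm F (Fin 0 → F)) n)) l := fun n =>
    essDimAt_congr
      (((oEquiv _).trans (isomCongr (plusFormEquiv n))).trans (oEquiv _).symm) l
  rw [h1, h1]
  refine essDimAt_addPlus_succ _ hl ?_
  rwa [Nat.card_congr (isomCongr (plusFormEquiv (F := F) m)).toEquiv,
    Nat.card_congr (isomCongr (plusFormEquiv (F := F) (m + 1))).toEquiv] at h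

end Comparison

/-! ### Arithmetic of the exponents of `l` in `q ^ j - 1` and `q ^ j + 1`. -/

section Arithmetic

/-- With `a j`, `b j` the exponents of `l` in `q ^ j - 1` and `q ^ j + 1`, this says that `O⁺(2m)`
falls short of `O(2m+1)` by `b m`. -/
lemma sum_plus_add {a b : ℕ → ℕ} (hab : ∀ j, 0 < j → a (2 * j) = a j + b j) (hb : b 0 = 0)
    (m : ℕ) : ∑ j ∈ Finset.range m, (a (j + 1) + b j) + b m =
      ∑ j ∈ Finset.range m, a (2 * (j + 1)) := by
  induction m with
  | zero => simpa
  | succ m ih =>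
    rw [Finset.sum_range_succ, Finset.sum_range_succ, ← ih, hab (m + 1) m.succ_pos]
    omega

/-- The analogue for minus type in dimension `2m + 2`, with defect `a (m + 1)` relative to
`O(2m+3)`. -/
lemma sum_minus_add {a b : ℕ → ℕ} (hab : ∀ j, 0 < j → a (2 * j) = a j + b j) (m : ℕ) :
    b 1 + ∑ j ∈ Finset.range m, (a (j + 1) + b (j + 2)) + a (m + 1) =
      ∑ j ∈ Finset.range (m + 1), a (2 * (j + 1)) := by
  induction m with
  | zero => simp [hab 1 one_pos, add_comm]
  | succ m ih =>
    rw [Finset.sum_range_succ, Finset.sum_range_succ _ (m + 1), ← ih,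
      hab (m + 1 + 1) (Nat.succ_pos _), show m + 1 + 1 = m + 2 from rfl]
    omega

/-- For `d` even the odd powers of `q` contribute nothing, so `GL_{2m}` and `O(2m+1)` have the same
`l`-part. -/
lemma sum_range_two_mul {a : ℕ → ℕ} (ha : ∀ j, a (2 * j + 1) = 0) (m : ℕ) :
    ∑ j ∈ Finset.range (2 * m), a (j + 1) = ∑ j ∈ Finset.range m, a (2 * (j + 1)) := by
  induction m with
  | zero => simp
  | succ m ih =>
    rw [show 2 * (m + 1) = 2 * m + 1 + 1 from rfl, Finset.sum_range_succ, Finset.sum_range_succ,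
      Finset.sum_range_succ, ih, ha, add_zero]
    rfl

variable {q l d : ℕ}

lemma orderOf_eq_of_isLeast (hq : 0 < q) (hd : IsLeast {e : ℕ | 0 < e ∧ l ∣ q ^ e - 1} d) :
    orderOf (q : ZMod l) = d := by
  have key : ∀ e, l ∣ q ^ e - 1 ↔ (q : ZMod l) ^ e = 1 := fun e => by
    rw [← ZMod.natCast_eq_zero_iff, Nat.cast_sub (Nat.one_le_pow _ _ hq), sub_eq_zero]
    simp
  rw [orderOf_eq_iff hd.1.1]
  refine ⟨(key d).mp hd.1.2, fun e hed he h => ?_⟩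
  exact hed.not_ge (hd.2 ⟨he, (key e).mpr h⟩)

lemma dvd_of_factorization_pow_sub_one_ne_zero (hq : 0 < q)
    (hd : IsLeast {e : ℕ | 0 < e ∧ l ∣ q ^ e - 1} d) {j : ℕ}
    (h : (q ^ j - 1).factorization l ≠ 0) : d ∣ j := by
  have h1 := Nat.dvd_of_factorization_pos h
  rw [← ZMod.natCast_eq_zero_iff, Nat.cast_sub (Nat.one_le_pow _ _ hq), sub_eq_zero] at h1
  rw [← orderOf_eq_of_isLeast hq hd]
  exact orderOf_dvd_of_pow_eq_one (by simpa using h1)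

/-- Modulo `l` the power `q ^ j` is `-1`, whose square is `1` and which differs from `1` because `l`
is odd. -/
lemma dvd_of_factorization_pow_add_one_ne_zero (hl : l.Prime) (hl2 : l ≠ 2) (hq : 0 < q)
    (hd : IsLeast {e : ℕ | 0 < e ∧ l ∣ q ^ e - 1} d) {j : ℕ}
    (h : (q ^ j + 1).factorization l ≠ 0) : d ∣ 2 * j ∧ ¬ d ∣ j := by
  have h1 := Nat.dvd_of_factorization_pos h
  have : Fact (2 < l) := ⟨lt_of_le_of_ne hl.two_le hl2.symm⟩
  rw [← ZMod.natCast_eq_zero_iff, Nat.cast_add, Nat.cast_pow, Nat.cast_one,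
    add_eq_zero_iff_eq_neg] at h1
  rw [← orderOf_eq_of_isLeast hq hd]
  refine ⟨orderOf_dvd_of_pow_eq_one ?_, fun h2 => ?_⟩
  · rw [mul_comm, pow_mul, h1, neg_one_sq]
  · rw [orderOf_dvd_iff_pow_eq_one, h1] at h2
    exact ZMod.neg_one_ne_one h2

lemma factorization_pow_two_mul_sub_one (hq : 1 < q) {j : ℕ} (hj : 0 < j) :
    (q ^ (2 * j) - 1).factorization l =
      (q ^ j - 1).factorization l + (q ^ j + 1).factorization l := by
  have h1 : 1 < q ^ j := Nat.one_lt_pow hj.ne' hq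
  rw [mul_comm, pow_mul, show (q ^ j) ^ 2 - 1 = (q ^ j - 1) * (q ^ j + 1) by
    rw [mul_comm, ← Nat.sq_sub_sq, one_pow],
    Nat.factorization_mul (by omega) (by omega), Finsupp.add_apply]

end Arithmetic

/-! ### The two cases according to the parity of `d`. -/

section Cases

variable {k : Type u} [Field k] {F : Type v} [Field F] [Finite F] {l d : ℕ}

/-- Since `d ∣ 2 * j` implies `d ∣ j` for odd `d`, no `q ^ j + 1` is divisible by `l`. So `GL_m`,
the split group containing it, and the groups obtained by adding one variable or an anisotropic
plane all have the same `l`-part. -/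
theorem essDimAt_O_of_odd (hl : l.Prime) (hl2 : l ≠ 2) (hq : ¬ l ∣ Nat.card F)
    (hd : IsLeast {e : ℕ | 0 < e ∧ l ∣ Nat.card F ^ e - 1} d) (hodd : Odd d) (m : ℕ) :
    (∀ c : F, c ≠ 0 → essDimAt k (O (oddForm c m)) l = essDimAt k (GL (Fin m) F) l) ∧
    essDimAt k (O (plusForm F m)) l = essDimAt k (GL (Fin m) F) l ∧
    ∀ N : QuadraticForm F (Fin 2 → F), N.Anisotropic →
      essDimAt k (O (addPlusForm N m)) l = essDimAt k (GL (Fin m) F) l := by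
  have hb : ∀ j, (Nat.card F ^ j + 1).factorization l = 0 := fun j => by
    by_contra h
    obtain ⟨h1, h2⟩ := dvd_of_factorization_pow_add_one_ne_zero hl hl2 Nat.card_pos hd h
    exact h2 ((Nat.coprime_two_right.mpr hodd).dvd_of_dvd_mul_left h1)
  have hplus : (Nat.card (GL (Fin m) F)).factorization l =
      (Nat.card (isom (plusForm F m))).factorization l := by
    rw [factorization_GL hl hq, factorization_isom_plus hl hq]
    simp [hb]
  have h1 := essDimAt_GL_eq_plus (k := k) hl hplus
  refine ⟨fun c hc => ?_, h1.symm, fun N hN => ?_⟩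
  · rw [h1]
    refine (essDimAt_plus_eq_addPlus _ hl ?_).symm
    have := factorization_isom_odd hl hq hl2 hc m
    rw [oddForm] at this
    rw [← hplus, factorization_GL hl hq, this]
    refine Finset.sum_congr rfl fun j _ => ?_
    rw [factorization_pow_two_mul_sub_one Finite.one_lt_card j.succ_pos, hb, add_zero]
  · rw [h1]
    refine (essDimAt_plus_eq_addPlus _ hl ?_).symm
    rw [← hplus, factorization_GL hl hq, factorization_isom_minus hl hq hl2 hN]
    have := hb 1
    rw [pow_one] at this
    simp [hb, this]

/-- With `d = 2e`, the defects of `O⁺(2m)` and `O⁻(2m)` relative to `GL_{2m}` are `b m` and `a m`;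
`a m` vanishes for `m / e` odd and `b m` for `m / e` even. A nonzero defect is exactly what
separates `GL_{2m-2}` from `GL_{2m}`. -/
theorem essDimAt_O_of_even (hl : l.Prime) (hl2 : l ≠ 2) (hq : ¬ l ∣ Nat.card F)
    (hd : IsLeast {e : ℕ | 0 < e ∧ l ∣ Nat.card F ^ e - 1} d) (heven : Even d) (m : ℕ) :
    (∀ c : F, c ≠ 0 → essDimAt k (O (oddForm c m)) l = essDimAt k (GL (Fin (2 * m)) F) l) ∧
    (Even (2 * m / d) →
      essDimAt k (O (plusForm F m)) l = essDimAt k (GL (Fin (2 * m)) F) l) ∧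
    (Odd (2 * m / d) →
      essDimAt k (O (plusForm F m)) l = essDimAt k (GL (Fin (2 * m - 2)) F) l) ∧
    ∀ N : QuadraticForm F (Fin 2 → F), 1 ≤ m → N.Anisotropic →
      (Odd (2 * m / d) →
        essDimAt k (O (addPlusForm N (m - 1))) l = essDimAt k (GL (Fin (2 * m)) F) l) ∧
      (Even (2 * m / d) →
        essDimAt k (O (addPlusForm N (m - 1))) l = essDimAt k (GL (Fin (2 * m - 2)) F) l) := by
  let a : ℕ → ℕ := fun j => (Nat.card F ^ j - 1).factorization l
  let b : ℕ → ℕ := fun j => (Nat.card F ^ j + 1).factorization l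
  obtain ⟨e, rfl⟩ : ∃ e, d = 2 * e := by obtain ⟨e, rfl⟩ := heven; exact ⟨e, by ring⟩
  have he : 0 < e := by have := hd.1.1; omega
  have hdiv : ∀ n, 2 * n / (2 * e) = n / e := fun n => Nat.mul_div_mul_left _ _ two_pos
  have ha : ∀ j, a j ≠ 0 → 2 * e ∣ j := fun j =>
    dvd_of_factorization_pow_sub_one_ne_zero Nat.card_pos hd
  have hb : ∀ j, b j ≠ 0 → e ∣ j ∧ ¬ 2 * e ∣ j := fun j h => by
    obtain ⟨h1, h2⟩ := dvd_of_factorization_pow_add_one_ne_zero hl hl2 Nat.card_pos hd h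
    exact ⟨Nat.dvd_of_mul_dvd_mul_left two_pos h1, h2⟩
  have hab : ∀ j, 0 < j → a (2 * j) = a j + b j := fun j hj =>
    factorization_pow_two_mul_sub_one Finite.one_lt_card hj
  have hb0 : b 0 = 0 := by
    by_contra h
    exact (hb 0 h).2 (dvd_zero _)
  have ha1 : ∀ j, a (2 * j + 1) = 0 := fun j => by
    by_contra h
    obtain ⟨s, hs⟩ := ha _ h
    have : 2 * e * s = 2 * (e * s) := by ring
    omega
  let W : ℕ → ℕ := fun m => ∑ j ∈ Finset.range m, a (2 * (j + 1))
  have hW : ∀ n, 0 < n → W n = W (n - 1) + (a n + b n) := fun n hn => by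
    obtain ⟨n, rfl⟩ := Nat.exists_eq_succ_of_ne_zero hn.ne'
    exact (Finset.sum_range_succ _ n).trans (congrArg _ (hab _ hn))
  have hGL : ∀ n, (Nat.card (GL (Fin (2 * n)) F)).factorization l = W n := fun n =>
    (factorization_GL hl hq _).trans (sum_range_two_mul ha1 n)
  have hGL' : ∀ n, (Nat.card (GL (Fin (2 * n + 1)) F)).factorization l = W n := fun n => by
    rw [← hGL, factorization_GL hl hq, factorization_GL hl hq, Finset.sum_range_succ]
    exact congrArg _ (ha1 n)
  have hP : ∀ n, (Nat.card (isom (plusForm F n))).factorization l + b n = W n := fun n => by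
    rw [factorization_isom_plus hl hq]
    exact sum_plus_add hab hb0 n
  have hM : ∀ N : QuadraticForm F (Fin 2 → F), N.Anisotropic → ∀ n, 0 < n →
      (Nat.card (isom (addPlusForm N (n - 1)))).factorization l + a n = W n := fun N hN n hn => by
    obtain ⟨n, rfl⟩ := Nat.exists_eq_succ_of_ne_zero hn.ne'
    rw [factorization_isom_minus hl hq hl2 hN]
    have := sum_minus_add hab n
    rw [show b 1 = (Nat.card F + 1).factorization l by simp only [b, pow_one]] at this
    exact this
  have ham : Odd (m / e) → a m = 0 := fun h => by
    by_contra h'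
    obtain ⟨s, rfl⟩ := ha m h'
    rw [show 2 * e * s = e * (2 * s) by ring, Nat.mul_div_cancel_left _ he] at h
    exact Nat.not_odd_iff_even.mpr (even_two_mul s) h
  have hbm : Even (m / e) → b m = 0 := fun h => by
    by_contra h'
    obtain ⟨⟨s, rfl⟩, h2⟩ := hb m h'
    rw [Nat.mul_div_cancel_left _ he] at h
    obtain ⟨t, rfl⟩ := h
    exact h2 ⟨t, by ring⟩
  have hcard : Fintype.card (Fin m ⊕ Fin m) = 2 * m := by simp; ring
  have hGLGL : a m = 0 → b m = 0 → 0 < m →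
      essDimAt k (GL (Fin (2 * m - 2)) F) l = essDimAt k (GL (Fin (2 * m)) F) l := by
    intro h1 h2 hm
    refine essDimAt_GL_eq_GL hl (by omega) ?_
    rw [show 2 * m - 2 = 2 * (m - 1) by omega, hGL, hGL, hW m hm, h1, h2, add_zero, add_zero]
  refine ⟨fun c hc => ?_, fun h => ?_, fun h => ?_, fun N hm hN => ⟨fun h => ?_, fun h => ?_⟩⟩
  -- `O(2m+1)` embeds in `GL_{2m+1}`, not visibly in `GL_{2m}`; the two general linear groups have
  -- the same `l`-part.
  · rw [essDimAt_GL_eq_GL hl (Nat.le_succ _) (by rw [hGL, hGL'])]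
    refine essDimAt_O_eq_GL _ hl (by simp; omega) ?_
    rw [factorization_isom_odd hl hq hl2 hc, hGL']
  · rw [hdiv] at h
    refine essDimAt_O_eq_GL _ hl hcard.le ?_
    rw [hGL, ← hP, hbm h, add_zero]
  · rw [hdiv] at h
    have hm : 0 < m := by
      rcases Nat.eq_zero_or_pos m with rfl | hm
      · simp at h
      · exact hm
    by_cases hb' : b m = 0
    · rw [hGLGL (ham h) hb' hm]
      refine essDimAt_O_eq_GL _ hl hcard.le ?_
      rw [hGL, ← hP, hb', add_zero]
    -- If `b m` and `b (m - 1)` were both nonzero, `e` would divide `1`, so `d = 2` would divide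
    -- neither of two consecutive integers. Hence `O⁺(2m-2)` has the same `l`-part as both `O⁺(2m)`
    -- and `GL_{2m-2}`.
    · have hb1 : b (m - 1) = 0 := by
        by_contra h1
        obtain ⟨h2, h3⟩ := hb _ h1
        obtain ⟨h4, h5⟩ := hb _ hb'
        have : e ∣ 1 := by
          have := Nat.dvd_sub h4 h2
          rwa [Nat.sub_sub_self hm] at this
        obtain rfl := Nat.dvd_one.mp this
        omega
      have h1 := hP m
      have h2 := hP (m - 1)
      have h3 := hW m hm
      rw [ham h] at h3
      rw [hb1] at h2
      obtain ⟨n, rfl⟩ : ∃ n, m = n + 1 := ⟨m - 1, by omega⟩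
      rw [Nat.add_sub_cancel] at h2 h3
      rw [← essDimAt_plus_succ hl (by omega), show 2 * (n + 1) - 2 = 2 * n by omega]
      refine essDimAt_O_eq_GL _ hl (by simp; omega) ?_
      rw [hGL]
      omega
  · rw [hdiv] at h
    refine essDimAt_O_eq_GL _ hl (by simp; omega) ?_
    rw [hGL, ← hM N hN m hm, ham h, add_zero]
  · rw [hdiv] at h
    by_cases ha' : a m = 0
    · rw [hGLGL ha' (hbm h) hm]
      refine essDimAt_O_eq_GL _ hl (by simp; omega) ?_
      rw [hGL, ← hM N hN m hm, ha', add_zero]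
    -- Here `d ≥ 2` divides `m`, hence not `m - 1`. So there is a hyperbolic plane to remove, and
    -- `O⁻(2m-2)` has the same `l`-part as both `O⁻(2m)` and `GL_{2m-2}`.
    · have hdm := ha m ha'
      have hm2 : 2 ≤ m := (Nat.le_of_dvd hm hdm).trans' (by omega)
      have ha2 : a (m - 1) = 0 := by
        by_contra h1
        have := Nat.dvd_sub hdm (ha _ h1)
        rw [Nat.sub_sub_self hm, Nat.dvd_one] at this
        omega
      have h1 := hM N hN m hm
      have h2 := hM N hN (m - 1) (by omega)
      have h3 := hW m hm
      rw [hbm h] at h3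
      rw [ha2] at h2
      obtain ⟨n, rfl⟩ := Nat.exists_eq_add_of_le' hm2
      rw [show n + 2 - 1 = n + 1 by omega] at *
      rw [show n + 1 - 1 = n by omega] at *
      rw [← essDimAt_addPlus_succ N hl (by omega), show 2 * (n + 2) - 2 = 2 * (n + 1) by omega]
      refine essDimAt_O_eq_GL _ hl (by simp; omega) ?_
      rw [hGL]
      omega

end Cases

end FiniteOrthogonal

end

open EssDim FiniteOrthogonal in
theorem theorem8 {k : Type u} [Field k] {F : Type v} [Field F] [Finite F]
    (p r q l d : ℕ) (hp : p.Prime) (hq : q = p ^ r) (hF : Nat.card F = q)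
    (hl : l.Prime) (hl2 : l ≠ 2) (hlp : l ≠ p) (hk : ringChar k ≠ l)
    (hd : IsLeast {e : ℕ | 0 < e ∧ l ∣ q ^ e - 1} d) :
    -- `n = 2m + 1`
    (∀ (m : ℕ) (c : F), c ≠ 0 →
      essDimAt k (POmega (oddForm c m)) l = essDimAt k (O (oddForm c m)) l ∧
      (Odd d → essDimAt k (O (oddForm c m)) l = essDimAt k (GL (Fin m) F) l) ∧
      (Even d → essDimAt k (O (oddForm c m)) l = essDimAt k (GL (Fin (2 * m)) F) l)) ∧
    -- `n = 2m`, plus type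
    (∀ m : ℕ,
      ((m = 1 → p = 2) →
        essDimAt k (POmega (plusForm F m)) l = essDimAt k (O (plusForm F m)) l) ∧
      (Odd d → essDimAt k (O (plusForm F m)) l = essDimAt k (GL (Fin m) F) l) ∧
      (Even d → Even (2 * m / d) →
        essDimAt k (O (plusForm F m)) l = essDimAt k (GL (Fin (2 * m)) F) l) ∧
      (Even d → Odd (2 * m / d) →
        essDimAt k (O (plusForm F m)) l = essDimAt k (GL (Fin (2 * m - 2)) F) l)) ∧
    -- `n = 2m`, minus type
    (∀ (m : ℕ) (N : QuadraticForm F (Fin 2 → F)), 1 ≤ m → N.Anisotropic →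
      ((m = 1 → p = 2) →
        essDimAt k (POmega (minusForm N m)) l = essDimAt k (O (minusForm N m)) l) ∧
      (Odd d → essDimAt k (O (minusForm N m)) l = essDimAt k (GL (Fin (m - 1)) F) l) ∧
      (Even d → Odd (2 * m / d) →
        essDimAt k (O (minusForm N m)) l = essDimAt k (GL (Fin (2 * m)) F) l) ∧
      (Even d → Even (2 * m / d) →
        essDimAt k (O (minusForm N m)) l = essDimAt k (GL (Fin (2 * m - 2)) F) l)) := by
  subst hF
  have : Fact p.Prime := ⟨hp⟩
  have : CharP F p := by
    have := Fintype.ofFinite F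
    exact charP_of_card_eq_prime_pow (by rw [← Nat.card_eq_fintype_card, hq])
  have hlq : ¬ l ∣ Nat.card F := by
    rw [hq]
    exact fun h => hlp ((Nat.prime_dvd_prime_iff_eq hl hp).mp (hl.dvd_of_dvd_pow h))
  have h0 : (0 : QuadraticForm F (Fin 0 → F)).Anisotropic := fun x _ => Subsingleton.elim _ _
  refine ⟨fun m c hc => ⟨?_, ?_, ?_⟩, fun m => ⟨fun hm => ?_, ?_, ?_, ?_⟩,
    fun m N hm hN => ⟨fun hm1 => ?_, ?_, ?_, ?_⟩⟩
  · have hN := anisotropic_smul_proj hc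
    refine essDimAt_POmega hl hl2 (not_dvd_index_commutator_SO hp hl hl2 hlp
      (regular_addPlusForm hN m) (generatedBy_addPlusForm p hN m) (Or.inr (Or.inl ?_)))
    exact ⟨m, by simp; ring⟩
  · exact fun h => (essDimAt_O_of_odd hl hl2 hlq hd h m).1 c hc
  · exact fun h => (essDimAt_O_of_even hl hl2 hlq hd h m).1 c hc
  · refine essDimAt_POmega hl hl2 (not_dvd_index_commutator_SO hp hl hl2 hlp
      ((regular_addPlusForm h0 m).of_isometryEquiv (plusFormEquiv m))
      ((generatedBy_addPlusForm p h0 m).of_isometryEquiv (plusFormEquiv m)) ?_)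
    -- Dimension two occurs only for `m = 1`; otherwise the dimension is zero or at least four.
    by_cases h1 : m = 1
    · exact Or.inl (hm h1)
    · simp only [Fintype.card_sum, Fintype.card_fin]
      omega
  · exact fun h => (essDimAt_O_of_odd hl hl2 hlq hd h m).2.1
  · exact fun h => (essDimAt_O_of_even hl hl2 hlq hd h m).2.1
  · exact fun h => (essDimAt_O_of_even hl hl2 hlq hd h m).2.2.1
  · refine essDimAt_POmega hl hl2 (not_dvd_index_commutator_SO hp hl hl2 hlp
      (regular_addPlusForm hN (m - 1)) (generatedBy_addPlusForm p hN (m - 1)) ?_)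
    by_cases h1 : m = 1
    · exact Or.inl (hm1 h1)
    · simp only [Fintype.card_sum, Fintype.card_fin]
      omega
  -- The minus form in dimension `2m` has only `m - 1` hyperbolic planes.
  · exact fun h => (essDimAt_O_of_odd hl hl2 hlq hd h (m - 1)).2.2 N hN
  · exact fun h => ((essDimAt_O_of_even hl hl2 hlq hd h m).2.2.2 N hm hN).1
  · exact fun h => ((essDimAt_O_of_even hl hl2 hlq hd h m).2.2.2 N hm hN).2
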